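/- Let $\Gamma\subseteq\mathbb N$ be a computable group, i.e. a computable set of natural numbers with a group structure whose multiplication $\Gamma\times\Gamma\to\Gamma$ is a computable function, and suppose that $\Gamma$ is amenable, i.e. there is a sequence $(F_n)_{n\ge 1}$ of non-empty finite subsets of $\Gamma$ with $|F_n\,\triangle\, gF_n|/|F_n|\to 0$ for every $g\in\Gamma$. For a finite binary word $w$ let $[w]\subseteq\{0,1\}^{\mathbb N}$ be the set of infinite sequences that begin with $w$. Let $\mu$ be a computable Borel probability measure on $\{0,1\}^{\mathbb N}$, i.e. the real numbers $\mu([w_1]\cup\dots\cup[w_k])$ are computable uniformly in the finite list of words $w_1,\dots,w_k$. Let $\Gamma$ act on $\{0,1\}^{\mathbb N}$ by $\mu$-preserving homeomorphisms, and suppose that the action is computable, i.e. there is a recursively enumerable set $E$ of triples $(g,w,v)$, with $g\in\Gamma$ and $w,v$ finite binary words, such that $g^{-1}([w])=\bigcup_{(g,w,v)\in E}[v]$ for all $g$ and $w$, and that it is ergodic, i.e. every Borel set $A$ with $\mu(g^{-1}A\,\triangle\, A)=0$ for all $g\in\Gamma$ satisfies $\mu(A)\in\{0,1\}$. Let $U\subseteq\{0,1\}^{\mathbb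 N}$ be an effectively open set, i.e. a union of a recursively enumerable set of cylinders $[w]$, and suppose that $\mu(U)<1$. Then the set $$U^{\ast}:=\bigcap_{g\in\Gamma} g^{-1}U$$ of all points whose whole $\Gamma$-orbit stays in $U$ is effectively $\mu$-null, i.e. there is a sequence $(V_n)_{n\ge1}$ of effectively open sets, uniformly in $n$ (there is a recursively enumerable set $D$ of pairs $(n,w)$ with $V_n=\bigcup_{(n,w)\in D}[w]$ for all $n$), such that $\mu(V_n)<2^{-n}$ for all $n\ge 1$ and $U^{\ast}\subseteq\bigcap_{n\ge1}V_n$. -/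

import Mathlib

open MeasureTheory Filter

/-- A discrete group is amenable if it has a left Følner sequence of finite subsets: a sequence
`F n` of finite (eventually nonempty) sets with `|g F n ∆ F n| / |F n| → 0` for every `g`. This is
Mathlib's `IsFoelner` for the left multiplication action and the counting measure. -/
def IsAmenableGroup (G : Type*) [Group G] : Prop :=
  letI : MeasurableSpace G := ⊤
  ∃ F : ℕ → Finset G, IsFoelner G (Measure.count : Measure G) atTop (fun n => (F n : Set G))

/-- A computable group: its underlying set is a computable set of natural numbers and its
multiplication is a computable function. -/
structure IsComputableGroup (Γ : Set ℕ) [Group Γ] : Prop where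
  computable_mem : ComputablePred (fun n : ℕ => n ∈ Γ)
  computable_mul : ∃ m : ℕ → ℕ → ℕ, Computable₂ m ∧ ∀ a b : Γ, m a b = ((a * b : Γ) : ℕ)

/-- The cylinder `[w]` of all infinite binary sequences that begin with the finite word `w`. -/
def wordCylinder (w : List Bool) : Set (ℕ → Bool) :=
  {ω | ∀ (i : ℕ) (h : i < w.length), ω i = w[i]}

/-- A set is effectively open if it is the union of a recursively enumerable set of cylinders. -/
def IsEffectivelyOpen (U : Set (ℕ → Bool)) : Prop :=
  ∃ E : Set (List Bool), REPred (fun w => w ∈ E) ∧ U = ⋃ w ∈ E, wordCylinder w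

/-- A uniformly effectively open sequence of subsets of Cantor space. -/
def IsUniformlyEffectivelyOpen (V : ℕ → Set (ℕ → Bool)) : Prop :=
  ∃ E : Set (ℕ × List Bool), REPred (fun p => p ∈ E) ∧
    ∀ n, V n = ⋃ w ∈ {w | (n, w) ∈ E}, wordCylinder w

/-- A family of real numbers is uniformly computable if an algorithm computes from the index and
from `i` a rational number, given here as `(p - q) / (r + 1)` with `p q r : ℕ`, at distance less
than `2⁻ⁱ` from the real number. -/
def IsUniformlyComputable {α : Type*} [Primcodable α] (x : α → ℝ) : Prop :=
  ∃ p q r : α → ℕ → ℕ, Computable₂ p ∧ Computable₂ q ∧ Computable₂ r ∧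
    ∀ a i, |((p a i : ℝ) - (q a i : ℝ)) / ((r a i : ℝ) + 1) - x a| < (1 / 2 : ℝ) ^ i

/-- A measure on Cantor space is computable if the measures of finite unions of cylinders are
computable uniformly in the finite list of words. -/
def IsComputableMeasure (μ : Measure (ℕ → Bool)) : Prop :=
  IsUniformlyComputable (fun L : List (List Bool) => μ.real (⋃ w ∈ L, wordCylinder w))

/-- An action on Cantor space is computable if the preimages of cylinders under the group elements
are effectively open, uniformly in the group element and the word. (In particular every group
element acts by a homeomorphism.) -/
def IsComputableAction (Γ : Set ℕ) [Group Γ] [MulAction Γ (ℕ → Bool)] : Prop :=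
  ∃ E : Set (ℕ × List Bool × List Bool), REPred (fun t => t ∈ E) ∧
    ∀ (g : Γ) (w : List Bool),
      (fun ω : ℕ → Bool => g • ω) ⁻¹' wordCylinder w =
        ⋃ v ∈ {v | ((g : ℕ), w, v) ∈ E}, wordCylinder v

/-- A Martin-Löf `μ`-test. -/
def IsMartinLofTest (μ : Measure (ℕ → Bool)) (V : ℕ → Set (ℕ → Bool)) : Prop :=
  IsUniformlyEffectivelyOpen V ∧ ∀ n, 1 ≤ n → μ (V n) < (2⁻¹ : ENNReal) ^ n

/-- A set is effectively `μ`-null if it is contained in the intersection of a Martin-Löf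
`μ`-test. -/
def IsEffectivelyNull (μ : Measure (ℕ → Bool)) (A : Set (ℕ → Bool)) : Prop :=
  ∃ V : ℕ → Set (ℕ → Bool), IsMartinLofTest μ V ∧ A ⊆ ⋂ n ∈ Set.Ici 1, V n

/-! Write `a = μ U < 1`. The core is an effective contraction: inside any cylinder `[w]`, and for
any precision `k`, there is an effectively open set containing `U* ∩ [w]` of measure at most `a * μ
[w] + 2 * 2⁻ᵏ`.

Ergodicity provides finitely many `g`, with repetitions, for which the proportion of `g` with `g • x
∈ [w]` is below `μ [w] + 2⁻ᵏ` outside a set of measure below `2⁻ᵏ`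
(`ErgodicSMul.exists_list_average_lt`). Let `X ⊆ [w]` be the set of points that every `g⁻¹` in the
list sends into `U`. By invariance `μ X ≤ μ (g⁻¹[w] ∩ U)` for each `g`. Averaging over the list and
integrating over `U` gives the contraction (`IsAveragingList.measureReal_inter_le`).

Such a list can be found by search. Missing the clopen set `[w]` is an open event, and the required
strict inequalities between computable reals are recursively enumerable, so a good list is
eventually certified (`REPred.isAveragingList`, `exists_isAveragingList`). The set `X` is
effectively open and splits into disjoint cylinders, the children of `w`. Repeating the construction
in every child, with precisions growing so fast that all errors are summable, leaves measure at most
`aⁿ + 4 * 2⁻ᵏ` after `n` generations (`measure_descendantSet_le`), while no point of `U*` is ever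
lost (`mem_descendantSet`). -/

/-! ### Closure properties of recursively enumerable predicates. -/

section RecursivelyEnumerable

variable {α β σ : Type*} [Primcodable α] [Primcodable β] [Primcodable σ]

theorem REPred.comp_computable {p : β → Prop} (hp : REPred p) {f : α → β} (hf : Computable f) :
    REPred fun a => p (f a) :=
  Partrec.comp hp hf

theorem Computable.rePred_exists {f : α → ℕ → Bool} (hf : Computable₂ f) :
    REPred fun a => ∃ n, f a n = true :=
  (Partrec.rfind hf.partrec₂).dom_re.of_eq fun a => by simp

theorem PrimrecRel.rePred_exists {r : α → ℕ → Prop} (hr : PrimrecRel r) :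
    REPred fun a => ∃ n, r a n := by
  classical
  exact (Computable.rePred_exists (f := fun a n => decide (r a n)) hr.decide.to_comp).of_eq
    fun a => by simp

/-- A recursively enumerable predicate is the projection of a primitive recursive relation. -/
theorem REPred.exists_primrecRel {p : α → Prop} (hp : REPred p) :
    ∃ r : α → ℕ → Prop, PrimrecRel r ∧ ∀ a, p a ↔ ∃ n, r a n := by
  obtain ⟨c, hc⟩ := Nat.Partrec.Code.exists_code.1 hp
  refine ⟨fun a n => (Nat.Partrec.Code.evaln n c (Encodable.encode a)).isSome = true, ?_, ?_⟩
  · refine Primrec₂.primrecRel ?_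
    simp only [Bool.decide_eq_true]
    exact Primrec.option_isSome.comp (Nat.Partrec.Code.primrec_evaln.comp
      ((Primrec.snd.pair (Primrec.const c)).pair (Primrec.encode.comp Primrec.fst)))
  · intro a
    have h1 : p a ↔ (Nat.Partrec.Code.eval c (Encodable.encode a)).Dom := by
      rw [hc]; simp [Part.assert]
    rw [h1, Part.dom_iff_mem]
    simp only [Nat.Partrec.Code.evaln_complete, Option.isSome_iff_exists]
    exact exists_comm

/-- Dovetailing: a single number `m` codes both the witness and the stage at which it is confirmed.
The list obtained from `decode m` has at most one element and makes the partial decoding a bounded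
quantifier. -/
theorem REPred.exists_snd {p : α × β → Prop} (hp : REPred p) : REPred fun a => ∃ b, p (a, b) := by
  obtain ⟨r, hr, h⟩ := hp.exists_primrecRel
  have h1 : PrimrecRel fun (x : β × ℕ) (a : α) => r (a, x.1) x.2 :=
    hr.comp (Primrec.snd.pair (Primrec.fst.comp Primrec.fst)) (Primrec.snd.comp Primrec.fst)
  have h2 : PrimrecRel fun (a : α) (m : ℕ) =>
      ∃ x ∈ (Encodable.decode m : Option (β × ℕ)).toList, r (a, x.1) x.2 :=
    h1.exists_mem_list.comp
      (Primrec.optionToList.comp (Primrec.decode.comp Primrec.snd)) Primrec.fst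
  refine h2.rePred_exists.of_eq fun a => ⟨?_, ?_⟩
  · rintro ⟨m, x, -, hx⟩
    exact ⟨x.1, (h _).2 ⟨_, hx⟩⟩
  · rintro ⟨b, hb⟩
    obtain ⟨n, hn⟩ := (h _).1 hb
    exact ⟨Encodable.encode (b, n), (b, n), by simp, hn⟩

theorem REPred.and {p q : α → Prop} (hp : REPred p) (hq : REPred q) :
    REPred fun a => p a ∧ q a := by
  obtain ⟨r, hr, h⟩ := hp.exists_primrecRel
  obtain ⟨s, hs, h'⟩ := hq.exists_primrecRel
  have h1 : PrimrecRel fun (a : α × ℕ) (m : ℕ) => r a.1 a.2 ∧ s a.1 m :=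
    PrimrecPred.and (hr.comp (Primrec.fst.comp Primrec.fst) (Primrec.snd.comp Primrec.fst))
      (hs.comp (Primrec.fst.comp Primrec.fst) Primrec.snd)
  exact h1.rePred_exists.exists_snd.of_eq fun a => by simp [h, h']

/-- "Confirmed before stage `y.2`", with the list element as first argument, as the closure lemmas
for quantifiers and filters over lists require. -/
theorem PrimrecRel.bounded_exists_swap {r : α × β → ℕ → Prop} (hr : PrimrecRel r) :
    PrimrecRel fun (b : β) (y : α × ℕ) => ∃ n < y.2, r (y.1, b) n := by
  have h0 : PrimrecRel fun (n : ℕ) (y : β × α) => r (y.2, y.1) n :=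
    hr.comp ((Primrec.snd.comp Primrec.snd).pair (Primrec.fst.comp Primrec.snd)) Primrec.fst
  have h1 : PrimrecPred fun z : β × α × ℕ => ∃ n ∈ List.range z.2.2, r (z.2.1, z.1) n :=
    h0.exists_mem_list.comp (Primrec.list_range.comp (Primrec.snd.comp Primrec.snd))
      (Primrec.fst.pair (Primrec.fst.comp Primrec.snd))
  have h2 : PrimrecPred fun z : β × α × ℕ => ∃ n < z.2.2, r (z.2.1, z.1) n :=
    h1.of_eq fun z => by simp
  exact h2.primrecRel

/-- Finitely many confirmations have a common stage, so the quantifier over the list moves inside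
the search for the stage. -/
theorem REPred.forall_mem_list {p : α × β → Prop} (hp : REPred p) :
    REPred fun x : α × List β => ∀ b ∈ x.2, p (x.1, b) := by
  obtain ⟨r, hr, h⟩ := hp.exists_primrecRel
  have h1 := hr.bounded_exists_swap
  have h2 : PrimrecRel fun (x : α × List β) (m : ℕ) => ∀ b ∈ x.2, ∃ n < m, r (x.1, b) n :=
    h1.forall_mem_list.comp (Primrec.snd.comp Primrec.fst)
      ((Primrec.fst.comp Primrec.fst).pair Primrec.snd)
  refine h2.rePred_exists.of_eq fun x => ⟨?_, ?_⟩
  · rintro ⟨m, hm⟩ b hb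
    obtain ⟨n, -, hn⟩ := hm b hb
    exact (h _).2 ⟨n, hn⟩
  · obtain ⟨a, l⟩ := x
    intro hx
    induction l with
    | nil => exact ⟨0, by simp⟩
    | cons b l ih =>
      obtain ⟨m, hm⟩ := ih fun c hc => hx c (List.mem_cons_of_mem _ hc)
      obtain ⟨n, hn⟩ := (h _).1 (hx b List.mem_cons_self)
      refine ⟨max m (n + 1), fun c hc => ?_⟩
      rcases List.mem_cons.1 hc with rfl | hc
      · exact ⟨n, by simp, hn⟩
      · obtain ⟨n', h1, h2⟩ := hm c hc
        exact ⟨n', lt_max_of_lt_left h1, h2⟩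

-- The number of elements confirmed by a stage increases with the stage and reaches the true count
-- on a finite list, so lower bounds of the count are semidecidable.
open Classical in
theorem REPred.le_countP {p : α × β → Prop} (hp : REPred p) :
    REPred fun x : α × List β × ℕ => x.2.2 ≤ x.2.1.countP fun b => decide (p (x.1, b)) := by
  obtain ⟨r, hr, h⟩ := hp.exists_primrecRel
  have h1 := hr.bounded_exists_swap
  have h2 : PrimrecRel fun (x : α × List β × ℕ) (m : ℕ) =>
      x.2.2 ≤ (x.2.1.filter fun b => decide (∃ n < m, r (x.1, b) n)).length :=
    Primrec.nat_le.comp (Primrec.snd.comp (Primrec.snd.comp Primrec.fst))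
      (Primrec.list_length.comp (h1.listFilter.comp
        (Primrec.fst.comp (Primrec.snd.comp Primrec.fst))
        ((Primrec.fst.comp Primrec.fst).pair Primrec.snd)))
  refine h2.rePred_exists.of_eq fun x => ?_
  obtain ⟨a, l, B⟩ := x
  simp only [← List.countP_eq_length_filter]
  constructor
  · rintro ⟨m, hm⟩
    refine hm.trans (List.countP_mono_left fun b _ hb => ?_)
    obtain ⟨n, -, hn⟩ := of_decide_eq_true hb
    exact decide_eq_true ((h _).2 ⟨n, hn⟩)
  · intro hB
    have : ∃ m, ∀ b ∈ l, p (a, b) → ∃ n < m, r (a, b) n := by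
      clear hB
      induction l with
      | nil => exact ⟨0, by simp⟩
      | cons b l ih =>
        obtain ⟨m, hm⟩ := ih
        by_cases hb : p (a, b)
        · obtain ⟨n, hn⟩ := (h _).1 hb
          refine ⟨max m (n + 1), fun c hc hpc => ?_⟩
          rcases List.mem_cons.1 hc with rfl | hc
          · exact ⟨n, by simp, hn⟩
          · obtain ⟨n', h1, h2⟩ := hm c hc hpc
            exact ⟨n', lt_max_of_lt_left h1, h2⟩
        · refine ⟨m, fun c hc hpc => ?_⟩
          rcases List.mem_cons.1 hc with rfl | hc
          · exact absurd hpc hb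
          · exact hm c hc hpc
    obtain ⟨m, hm⟩ := this
    refine ⟨m, hB.trans (List.countP_mono_left fun b hb hpb => ?_)⟩
    exact decide_eq_true (hm b hb (of_decide_eq_true hpb))

/-- A total recursively enumerable relation has a computable selection function. -/
theorem REPred.exists_computable_selection {p : α × β → Prop} (hp : REPred p)
    (h : ∀ a, ∃ b, p (a, b)) : ∃ f : α → β, Computable f ∧ ∀ a, p (a, f a) := by
  classical
  obtain ⟨r, hr, hpr⟩ := hp.exists_primrecRel
  have h1 : PrimrecRel fun (x : β × ℕ) (a : α) => r (a, x.1) x.2 :=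
    hr.comp (Primrec.snd.pair (Primrec.fst.comp Primrec.fst)) (Primrec.snd.comp Primrec.fst)
  let q : α → ℕ → Prop := fun a m =>
    ∃ x ∈ (Encodable.decode m : Option (β × ℕ)).toList, r (a, x.1) x.2
  have h2 : PrimrecRel q :=
    h1.exists_mem_list.comp
      (Primrec.optionToList.comp (Primrec.decode.comp Primrec.snd)) Primrec.fst
  have hq : ∀ a, ∃ m, q a m := fun a => by
    obtain ⟨b, hb⟩ := h a
    obtain ⟨n, hn⟩ := (hpr _).1 hb
    exact ⟨Encodable.encode (b, n), (b, n), by simp, hn⟩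
  have hfind : Computable fun a => Nat.find (hq a) :=
    Computable.find (PrimrecPred.computablePred h2) hq
  have hopt : ∀ a, ∃ x, (Encodable.decode (Nat.find (hq a)) : Option (β × ℕ)) = some x ∧
      r (a, x.1) x.2 := fun a => by
    obtain ⟨x, hx, hr⟩ := Nat.find_spec (hq a)
    exact ⟨x, by simpa using hx, hr⟩
  choose f hf hfr using hopt
  have hc : Computable f := by
    rw [← Computable.option_some_iff]
    exact (Computable.decode.comp hfind).of_eq fun a => hf a
  exact ⟨fun a => (f a).1, Computable.fst.comp hc, fun a => (hpr _).2 ⟨_, hfr a⟩⟩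

/-- `IterRel R n s t`: one can go from `s` to `t` in `n` steps along `R`. -/
def IterRel {σ : Type*} (R : σ → σ → Prop) : ℕ → σ → σ → Prop
  | 0, s, t => s = t
  | n + 1, s, t => ∃ s', R s s' ∧ IterRel R n s' t

/-- Replaces `n` nested existentials by one existential over the list of visited states, so that
enumerability holds uniformly in `n`. -/
theorem iterRel_iff_exists_list {σ : Type*} {R : σ → σ → Prop} {n : ℕ} {s t : σ} :
    IterRel R n s t ↔ ∃ l : List σ, l[0]? = some s ∧ l[n]? = some t ∧
      ∀ i ∈ List.range n, ∃ a b, (l[i]? = some a ∧ l[i + 1]? = some b) ∧ R a b := by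
  induction n generalizing s with
  | zero =>
    constructor
    · rintro rfl
      exact ⟨[s], by simp⟩
    · rintro ⟨l, h0, h1, -⟩
      exact Option.some.inj (h0.symm.trans h1)
  | succ n ih =>
    constructor
    · rintro ⟨s', hR, h⟩
      obtain ⟨l, h0, hn, hl⟩ := ih.1 h
      refine ⟨s :: l, by simp, by simpa using hn, fun i hi => ?_⟩
      cases i with
      | zero => exact ⟨s, s', ⟨by simp, by simpa using h0⟩, hR⟩
      | succ i => simpa using hl i (by simpa using hi)
    · rintro ⟨l, h0, hn, hl⟩
      obtain ⟨a, b, ⟨ha, hb⟩, hR⟩ := hl 0 (by simp)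
      obtain rfl : s = a := Option.some.inj (h0.symm.trans ha)
      refine ⟨b, hR, ih.2 ⟨l.tail, ?_, ?_, fun i hi => ?_⟩⟩
      · simpa using hb
      · simpa using hn
      · simpa using hl (i + 1) (by simpa using hi)

theorem PrimrecPred.rePred {p : α → Prop} (hp : PrimrecPred p) : REPred p :=
  hp.computablePred.to_re

theorem REPred.iterRel {R : σ → σ → Prop} (hR : REPred fun x : σ × σ => R x.1 x.2) :
    REPred fun x : ℕ × σ × σ => IterRel R x.1 x.2.1 x.2.2 := by
  classical
  have e : PrimrecPred fun x : ((List σ × ℕ) × σ) × σ =>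
      x.1.1.1[x.1.1.2]? = some x.1.2 ∧ x.1.1.1[x.1.1.2 + 1]? = some x.2 := by
    have h1 : Primrec fun x : ((List σ × ℕ) × σ) × σ => x.1.1.1 :=
      Primrec.fst.comp (Primrec.fst.comp Primrec.fst)
    have h2 : Primrec fun x : ((List σ × ℕ) × σ) × σ => x.1.1.2 :=
      Primrec.snd.comp (Primrec.fst.comp Primrec.fst)
    exact (Primrec.eq.comp (Primrec.list_getElem?.comp h1 h2)
      (Primrec.option_some.comp (Primrec.snd.comp Primrec.fst))).and
      (Primrec.eq.comp (Primrec.list_getElem?.comp h1 (Primrec.succ.comp h2))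
      (Primrec.option_some.comp Primrec.snd))
  have h1 : REPred fun x : List σ × ℕ =>
      ∃ a b, (x.1[x.2]? = some a ∧ x.1[x.2 + 1]? = some b) ∧ R a b :=
    (e.rePred.and (hR.comp_computable (f := fun x : ((List σ × ℕ) × σ) × σ => (x.1.2, x.2))
      ((Computable.snd.comp Computable.fst).pair Computable.snd))).exists_snd.exists_snd
  have h2 := h1.forall_mem_list.comp_computable
    (f := fun x : (ℕ × σ × σ) × List σ => (x.2, List.range x.1.1))
    (Computable.snd.pair (Primrec.list_range.comp (Primrec.fst.comp Primrec.fst)).to_comp)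
  have e2 : PrimrecPred fun x : (ℕ × σ × σ) × List σ =>
      x.2[0]? = some x.1.2.1 ∧ x.2[x.1.1]? = some x.1.2.2 :=
    (Primrec.eq.comp (Primrec.list_getElem?.comp Primrec.snd (Primrec.const 0))
      (Primrec.option_some.comp (Primrec.fst.comp (Primrec.snd.comp Primrec.fst)))).and
    (Primrec.eq.comp (Primrec.list_getElem?.comp Primrec.snd (Primrec.fst.comp Primrec.fst))
      (Primrec.option_some.comp (Primrec.snd.comp (Primrec.snd.comp Primrec.fst))))
  refine (e2.rePred.and h2).exists_snd.of_eq fun x => ?_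
  rw [iterRel_iff_exists_list]
  simp only [and_assoc]

end RecursivelyEnumerable

/-! ### Fixed vectors in closed convex hulls of orbits. -/

section MeanErgodic

open scoped Topology

/-- Averages of an orbit over nonempty lists of group elements. -/
def orbitAverages (M : Type*) {H : Type*} [SMul M H] [AddCommGroup H] [Module ℝ H] (f : H) :
    Set H :=
  {v | ∃ l : List M, l ≠ [] ∧ v = (l.length : ℝ)⁻¹ • (l.map (· • f)).sum}

variable {M H : Type*} [Group M] [NormedAddCommGroup H] [InnerProductSpace ℝ H]
  [DistribMulAction M H]

/-- Lists may repeat elements, so rational weights are obtained by concatenating copies of both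
lists; multiplying by the length of the other list compensates for the different lengths. -/
theorem orbitAverages_rational_combination {f a b : H} (ha : a ∈ orbitAverages M f)
    (hb : b ∈ orbitAverages M f) {p n : ℕ} (hn : 0 < n) (hp : p ≤ n) :
    ((p : ℝ) / n) • a + (1 - (p : ℝ) / n) • b ∈ orbitAverages M f := by
  obtain ⟨l, hl, rfl⟩ := ha
  obtain ⟨l', hl', rfl⟩ := hb
  obtain ⟨r, rfl⟩ := Nat.exists_eq_add_of_le hp
  have hL : (0 : ℝ) < l.length := by exact_mod_cast List.length_pos_iff.2 hl
  have hL' : (0 : ℝ) < l'.length := by exact_mod_cast List.length_pos_iff.2 hl'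
  have hn' : (0 : ℝ) < (p : ℝ) + r := by exact_mod_cast hn
  let m := (List.replicate (p * l'.length) l).flatten ++ (List.replicate (r * l.length) l').flatten
  have hm : m.length = (p + r) * l.length * l'.length := by
    simp [m]; ring
  refine ⟨m, ?_, ?_⟩
  · rw [← List.length_pos_iff, hm]
    exact Nat.mul_pos (Nat.mul_pos hn (List.length_pos_iff.2 hl)) (List.length_pos_iff.2 hl')
  · rw [hm]
    simp only [m, List.map_append, List.sum_append, List.map_flatten, List.map_replicate,
      List.sum_flatten, List.sum_replicate, ← Nat.cast_smul_eq_nsmul ℝ, smul_add, smul_smul]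
    congr 2 <;> push_cast <;> field_simp
    ring

theorem convex_closure_orbitAverages (f : H) : Convex ℝ (closure (orbitAverages M f)) := by
  have key : ∀ a ∈ orbitAverages M f, ∀ b ∈ orbitAverages M f, ∀ t : ℝ, 0 ≤ t → t ≤ 1 →
      t • a + (1 - t) • b ∈ closure (orbitAverages M f) := by
    intro a ha b hb t ht0 ht1
    have h1 : Tendsto (fun n : ℕ => ((⌊t * n⌋₊ : ℝ) / n)) atTop (𝓝 t) :=
      (tendsto_nat_floor_mul_div_atTop ht0).comp tendsto_natCast_atTop_atTop
    refine mem_closure_of_tendsto ((h1.smul_const a).add ((h1.const_sub 1).smul_const b)) ?_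
    filter_upwards [eventually_gt_atTop 0] with n hn
    refine orbitAverages_rational_combination ha hb hn (Nat.floor_le_of_le ?_)
    exact mul_le_of_le_one_left n.cast_nonneg ht1
  intro x hx y hy a b ha hb hab
  obtain rfl : b = 1 - a := by linarith
  rw [← closure_closure]
  refine map_mem_closure₂ (f := fun u v : H => a • u + (1 - a) • v) (by fun_prop) hx hy ?_
  exact fun u hu v hv => key u hu v hv a ha (by linarith)

variable [SMulCommClass M ℝ H]

theorem smul_mem_orbitAverages {f v : H} (m : M) (hv : v ∈ orbitAverages M f) :
    m • v ∈ orbitAverages M f := by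
  obtain ⟨l, hl, rfl⟩ := hv
  refine ⟨l.map (m * ·), by simpa using hl, ?_⟩
  rw [smul_comm, List.smul_sum]
  simp [Function.comp_def, mul_smul]

/-- The element of minimal norm in the closed convex hull of an orbit is fixed. -/
theorem exists_fixed_mem_closure_orbitAverages [IsIsometricSMul M H] [CompleteSpace H]
    (f : H) :
    ∃ h ∈ closure (orbitAverages M f), ∀ m : M, m • h = h := by
  have hne : (closure (orbitAverages M f)).Nonempty :=
    Set.Nonempty.closure ⟨_, [1], by simp, rfl⟩
  have hconv := convex_closure_orbitAverages (M := M) f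
  obtain ⟨h, hK, hmin⟩ := exists_norm_eq_iInf_of_complete_convex hne isClosed_closure.isComplete
    hconv 0
  rw [norm_eq_iInf_iff_real_inner_le_zero hconv hK] at hmin
  refine ⟨h, hK, fun m => ?_⟩
  have hmK : m • h ∈ closure (orbitAverages M f) :=
    map_mem_closure (continuous_const_smul m) hK fun v hv => smul_mem_orbitAverages m hv
  have hnorm : ‖m • h‖ = ‖h‖ := by
    have := dist_smul m h 0
    rwa [smul_zero, dist_zero_right, dist_zero_right] at this
  -- The variational inequality at the point nearest to `0` bounds `‖h‖ ^ 2` by the inner product of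
  -- `h` and `m • h`; as the two norms agree, this forces equality of the vectors.
  have h1 := hmin _ hmK
  have h2 : ‖m • h - h‖ ^ 2 ≤ 0 := by
    rw [norm_sub_sq_real, hnorm]
    rw [zero_sub, inner_neg_left, inner_sub_right, real_inner_self_eq_norm_sq,
      real_inner_comm] at h1
    linarith
  have h3 : ‖m • h - h‖ = 0 := by
    have := sq_nonneg ‖m • h - h‖
    exact pow_eq_zero_iff two_ne_zero |>.1 (le_antisymm h2 this)
  exact sub_eq_zero.1 (norm_eq_zero.1 h3)

end MeanErgodic

/-! ### The mean ergodic theorem for an indicator function. -/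

section ErgodicAction


variable {G α : Type*} [Group G] [MeasurableSpace α] [MulAction G α]
  {μ : Measure α} [ErgodicSMul G α μ]

theorem ErgodicSMul.ae_eq_const_of_forall_ae_eq_comp {f : α → ℝ} (hf : Measurable f)
    (h : ∀ g : G, (fun x => f (g • x)) =ᵐ[μ] f) : ∃ c, f =ᵐ[μ] Function.const α c := by
  refine exists_eventuallyEq_const_of_forall_separating MeasurableSet fun U hU => ?_
  have := ErgodicSMul.aeconst_of_forall_preimage_smul_ae_eq (G := G) (μ := μ) (hf hU) fun g =>
    ((h g).mono fun x hx => by simp only [Set.preimage, Set.mem_ofPred_eq, hx]).set_eq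
  rcases eventuallyConst_set.1 this with h | h
  · exact .inl h
  · exact .inr h

variable [MeasurableConstSMul G α] [IsProbabilityMeasure μ]

/-- The fixed vector in the closed hull is almost everywhere constant by ergodicity, and its
integral determines the constant. -/
theorem ErgodicSMul.const_mem_closure_orbitAverages {s : Set α} (hs : MeasurableSet s) :
    Lp.const 2 μ (μ.real s) ∈ closure (orbitAverages Gᵈᵐᵃ
      (indicatorConstLp 2 hs (measure_ne_top μ s) (1 : ℝ))) := by
  set f := indicatorConstLp 2 hs (measure_ne_top μ s) (1 : ℝ)
  obtain ⟨h, hmem, hfix⟩ := exists_fixed_mem_closure_orbitAverages (M := Gᵈᵐᵃ) f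
  have hm := Lp.stronglyMeasurable h
  obtain ⟨c, hc⟩ := ErgodicSMul.ae_eq_const_of_forall_ae_eq_comp (G := G) (μ := μ)
    hm.measurable fun g => by
      have := DomMulAct.smul_Lp_ae_eq (DomMulAct.mk g) h
      rw [hfix] at this
      exact this.symm
  have hconst : h = Lp.const 2 μ c := Lp.ext (hc.trans (Lp.coeFn_const 2 μ c).symm)
  -- The integral, written as an inner product with `1` to make its continuity and linearity
  -- immediate.
  let φ : Lp ℝ 2 μ → ℝ := fun v => inner ℝ
    (indicatorConstLp 2 MeasurableSet.univ (measure_ne_top μ Set.univ) (1 : ℝ)) v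
  have hφ : ∀ v, φ v = ∫ x, v x ∂μ := fun v => by
    simp only [φ]
    rw [L2.inner_indicatorConstLp_one, setIntegral_univ]
  have hφf : ∀ m : Gᵈᵐᵃ, φ (m • f) = μ.real s := fun m => by
    obtain ⟨g, rfl⟩ := DomMulAct.mk.surjective m
    rw [hφ]
    simp only [f]
    rw [DomMulAct.mk_smul_indicatorConstLp, integral_indicatorConstLp]
    simp [measureReal_def]
  have hφS : ∀ v ∈ orbitAverages Gᵈᵐᵃ f, φ v = μ.real s := by
    rintro _ ⟨l, hl, rfl⟩
    have h1 : φ (l.map (· • f)).sum = l.length * μ.real s := by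
      clear hl
      induction l with
      | nil => simp [φ]
      | cons a l ih =>
        have : φ ((a :: l).map (· • f)).sum = φ (a • f) + φ (l.map (· • f)).sum := by
          simp only [φ, List.map_cons, List.sum_cons, inner_add_right]
        rw [this, ih, hφf]; push_cast [List.length_cons]; ring
    have h2 : φ ((l.length : ℝ)⁻¹ • (l.map (· • f)).sum)
        = (l.length : ℝ)⁻¹ * φ (l.map (· • f)).sum := by
      simp only [φ, inner_smul_right]
    have hL : (l.length : ℝ) ≠ 0 := by exact_mod_cast (List.length_pos_iff.2 hl).ne'
    rw [h2, h1]; field_simp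
  have hcl : IsClosed {v | φ v = μ.real s} :=
    isClosed_eq (by fun_prop) continuous_const
  have hφh : φ h = μ.real s := closure_minimal hφS hcl hmem
  have hcs : c = μ.real s := by
    rw [← hφh, hφ, integral_congr_ae hc]; simp
  rwa [← hcs, ← hconst]

/-- A form of the mean ergodic theorem: suitable averages of the translates of an indicator function
are close in measure to the constant function with the same integral. -/
theorem ErgodicSMul.exists_list_average_lt {s : Set α} (hs : MeasurableSet s) {ε : ℝ}
    (hε : 0 < ε) : ∃ l : List G, l ≠ [] ∧
      μ.real {x | μ.real s + ε ≤
        (l.length : ℝ)⁻¹ * (l.map fun g => s.indicator (fun _ => (1 : ℝ)) (g • x)).sum} < ε := by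
  have hmem := ErgodicSMul.const_mem_closure_orbitAverages (G := G) (μ := μ) hs
  -- Chebyshev for the square bounds the exceptional measure by `δ ^ 2 / ε ^ 2 = min ε 1 ^ 2`, which
  -- is at most `ε`.
  set δ := ε * min ε 1 with hδ
  obtain ⟨_, ⟨l, hl, rfl⟩, hv⟩ := Metric.mem_closure_iff.1 hmem δ (by positivity)
  set f := indicatorConstLp 2 hs (measure_ne_top μ s) (1 : ℝ)
  refine ⟨l.map DomMulAct.mk.symm, by simpa using hl, ?_⟩
  rw [dist_comm, dist_eq_norm] at hv
  have hsum : ∀ l : List Gᵈᵐᵃ, ∀ᵐ x ∂μ, (l.map (· • f)).sum x =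
      ((l.map DomMulAct.mk.symm).map fun g => s.indicator (fun _ => (1 : ℝ)) (g • x)).sum := by
    intro l
    induction l with
    | nil => exact Lp.coeFn_zero ℝ 2 μ
    | cons m l ih =>
      obtain ⟨g, rfl⟩ := DomMulAct.mk.surjective m
      have h1 : (DomMulAct.mk g • f : Lp ℝ 2 μ) =ᵐ[μ]
          ((g • ·) ⁻¹' s).indicator fun _ => (1 : ℝ) := by
        simp only [f]
        rw [DomMulAct.mk_smul_indicatorConstLp]
        exact indicatorConstLp_coeFn
      filter_upwards [ih, h1, Lp.coeFn_add (DomMulAct.mk g • f) (l.map (· • f)).sum]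
        with x hx hx1 hx2
      simp only [List.map_cons, List.sum_cons]
      rw [hx2, Pi.add_apply, hx, hx1]
      rfl
  set v : Lp ℝ 2 μ := (l.length : ℝ)⁻¹ • (l.map (· • f)).sum - Lp.const 2 μ (μ.real s) with hvdef
  have hvx : ∀ᵐ x ∂μ, v x = (l.length : ℝ)⁻¹ * ((l.map DomMulAct.mk.symm).map fun g =>
      s.indicator (fun _ => (1 : ℝ)) (g • x)).sum - μ.real s := by
    filter_upwards [hsum l, Lp.coeFn_const 2 μ (μ.real s),
      Lp.coeFn_smul (l.length : ℝ)⁻¹ (l.map (· • f)).sum,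
      Lp.coeFn_sub ((l.length : ℝ)⁻¹ • (l.map (· • f)).sum) (Lp.const 2 μ (μ.real s))]
      with x h1 h2 h3 h4
    rw [hvdef, h4, Pi.sub_apply, h3, Pi.smul_apply, h1, h2]
    rfl
  have hle : μ.real {x | μ.real s + ε ≤ ((l.map DomMulAct.mk.symm).length : ℝ)⁻¹ *
      ((l.map DomMulAct.mk.symm).map fun g => s.indicator (fun _ => (1 : ℝ)) (g • x)).sum} ≤
      μ.real {x | ε ^ 2 ≤ inner ℝ (v x) (v x)} := by
    refine ENNReal.toReal_mono (measure_ne_top _ _) (measure_mono_ae (hvx.mono fun x hx h => ?_))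
    simp only [List.length_map] at h
    have h : μ.real s + ε ≤ _ := h
    change ε ^ 2 ≤ inner ℝ (v x) (v x)
    rw [real_inner_self_eq_norm_sq, Real.norm_eq_abs, sq_abs, hx]
    exact pow_le_pow_left₀ hε.le (by linarith) 2
  have hcheb := mul_meas_ge_le_integral_of_nonneg (μ := μ)
    (Eventually.of_forall fun x => real_inner_self_nonneg (x := v x))
    (L2.integrable_inner (𝕜 := ℝ) v v) (ε ^ 2)
  rw [← L2.inner_def, real_inner_self_eq_norm_sq] at hcheb
  have h1 : ‖v‖ ^ 2 < δ ^ 2 := pow_lt_pow_left₀ hv (norm_nonneg _) two_ne_zero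
  have h2 : ε ^ 2 * μ.real {x | ε ^ 2 ≤ inner ℝ (v x) (v x)} < ε ^ 2 * min ε 1 ^ 2 := by
    rw [← mul_pow]; exact hcheb.trans_lt h1
  have h3 := lt_of_mul_lt_mul_left h2 (by positivity)
  have h4 : min ε 1 ^ 2 ≤ ε := by
    have h5 : 0 ≤ min ε 1 := by positivity
    nlinarith [min_le_left ε 1, min_le_right ε 1]
  exact hle.trans_lt (h3.trans_le h4)

end ErgodicAction

/-! ### Prefixes, cylinders and measurability. -/

section Words

/-- The word formed by the first `n` letters of a sequence. -/
def prefixWord (x : ℕ → Bool) (n : ℕ) : List Bool := List.ofFn fun i : Fin n => x i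

@[simp] theorem length_prefixWord (x : ℕ → Bool) (n : ℕ) : (prefixWord x n).length = n := by
  simp [prefixWord]

theorem mem_wordCylinder_iff {x : ℕ → Bool} {w : List Bool} :
    x ∈ wordCylinder w ↔ prefixWord x w.length = w := by
  constructor
  · intro h
    refine List.ext_getElem (by simp) fun i h1 h2 => ?_
    simpa [prefixWord] using h i h2
  · intro h i hi
    have : (prefixWord x w.length)[i]'(by simpa using hi) = w[i] := by simp only [h]
    simpa [prefixWord] using this

theorem mem_wordCylinder_prefixWord (x : ℕ → Bool) (n : ℕ) :
    x ∈ wordCylinder (prefixWord x n) := by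
  simp [mem_wordCylinder_iff]

theorem take_prefixWord (x : ℕ → Bool) (n m : ℕ) :
    (prefixWord x n).take m = prefixWord x (min m n) :=
  List.ext_getElem (by simp) fun i h1 h2 => by simp [prefixWord]

theorem wordCylinder_subset_of_take {u w : List Bool} (h : u.take w.length = w) :
    wordCylinder u ⊆ wordCylinder w := by
  intro x hx
  rw [mem_wordCylinder_iff] at hx ⊢
  have hl : w.length ≤ u.length := by
    have := congrArg List.length h
    rw [List.length_take] at this; omega
  rw [← hx, take_prefixWord, min_eq_left hl] at h
  exact h

theorem wordCylinder_subset_take (u : List Bool) (n : ℕ) :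
    wordCylinder u ⊆ wordCylinder (u.take n) :=
  wordCylinder_subset_of_take (by simp [List.take_eq_take_iff])

theorem take_eq_of_mem_wordCylinder {x : ℕ → Bool} {u v : List Bool} (hu : x ∈ wordCylinder u)
    (hv : x ∈ wordCylinder v) (h : u.length ≤ v.length) : v.take u.length = u := by
  rw [mem_wordCylinder_iff] at hu hv
  rw [← hv, take_prefixWord, min_eq_left h, hu]

theorem eq_of_mem_wordCylinder_of_length_eq {x : ℕ → Bool} {u v : List Bool}
    (hu : x ∈ wordCylinder u) (hv : x ∈ wordCylinder v) (h : u.length = v.length) : u = v := by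
  rw [mem_wordCylinder_iff] at hu hv
  rw [← hu, ← hv, h]

theorem measurableSet_wordCylinder (w : List Bool) : MeasurableSet (wordCylinder w) := by
  have : wordCylinder w = ⋂ i : Fin w.length, (fun x : ℕ → Bool => x i) ⁻¹' {w[i]} := by
    ext x; simp [wordCylinder, Fin.forall_iff]
  rw [this]
  exact MeasurableSet.iInter fun i => measurable_pi_apply _ (measurableSet_singleton _)

theorem measurableSet_biUnion_wordCylinder (S : Set (List Bool)) :
    MeasurableSet (⋃ w ∈ S, wordCylinder w) :=
  MeasurableSet.biUnion S.to_countable fun w _ => measurableSet_wordCylinder w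

theorem measurable_of_preimage_wordCylinder {f : (ℕ → Bool) → ℕ → Bool}
    (hf : ∀ w, MeasurableSet (f ⁻¹' wordCylinder w)) : Measurable f := by
  refine measurable_pi_iff.2 fun i => measurable_to_countable' fun b => ?_
  have : (fun x => f x i) ⁻¹' {b} =
      ⋃ w ∈ {w : List Bool | w[i]? = some b}, f ⁻¹' wordCylinder w := by
    ext x
    simp only [Set.mem_preimage, Set.mem_singleton_iff, Set.mem_iUnion, exists_prop]
    constructor
    · rintro rfl
      exact ⟨prefixWord (f x) (i + 1), by simp [prefixWord, -List.ofFn_succ],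
        mem_wordCylinder_prefixWord _ _⟩
    · rintro ⟨w, hw, hx⟩
      obtain ⟨hi, hw⟩ := List.getElem?_eq_some_iff.1 hw
      rw [← hw]
      exact hx i hi
  rw [this]
  exact MeasurableSet.biUnion (Set.to_countable _) fun w _ => hf w

theorem measurable_smul_of_isComputableAction {Γ : Set ℕ} [Group Γ] [MulAction Γ (ℕ → Bool)]
    (h : IsComputableAction Γ) : MeasurableConstSMul Γ (ℕ → Bool) := by
  obtain ⟨E, -, hE⟩ := h
  refine ⟨fun g => measurable_of_preimage_wordCylinder fun w => ?_⟩
  rw [hE]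
  exact measurableSet_biUnion_wordCylinder _

/-- The measure of an open set is approximated by the measures of finite unions of cylinders. -/
theorem exists_list_lt_measureReal (μ : Measure (ℕ → Bool)) [IsFiniteMeasure μ]
    (S : Set (List Bool)) {a : ℝ} (ha : a < μ.real (⋃ w ∈ S, wordCylinder w)) :
    ∃ L : List (List Bool), (∀ w ∈ L, w ∈ S) ∧ a < μ.real (⋃ w ∈ L, wordCylinder w) := by
  classical
  let L : ℕ → List (List Bool) := fun n =>
    ((List.range n).filterMap fun i => Encodable.decode (α := List Bool) i).filter (· ∈ S)
  have hL : ∀ n w, w ∈ L n ↔ (∃ i < n, Encodable.decode (α := List Bool) i = some w) ∧ w ∈ S := by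
    intro n w; simp [L]
  have hmono : Monotone fun n => ⋃ w ∈ L n, wordCylinder w := by
    intro n m hnm
    refine Set.biUnion_subset_biUnion_left fun w hw => ?_
    obtain ⟨⟨i, hi, h⟩, hS⟩ := (hL _ _).1 hw
    exact (hL _ _).2 ⟨⟨i, hi.trans_le hnm, h⟩, hS⟩
  have hU : ⋃ n, ⋃ w ∈ L n, wordCylinder w = ⋃ w ∈ S, wordCylinder w := by
    ext x
    simp only [Set.mem_iUnion, exists_prop]
    constructor
    · rintro ⟨n, w, hw, hx⟩
      exact ⟨w, ((hL _ _).1 hw).2, hx⟩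
    · rintro ⟨w, hw, hx⟩
      exact ⟨Encodable.encode w + 1, w, (hL _ _).2 ⟨⟨_, Nat.lt_succ_self _, by simp⟩, hw⟩, hx⟩
  have ht := tendsto_measure_iUnion_atTop (μ := μ) hmono
  rw [hU] at ht
  have ht' := (ENNReal.tendsto_toReal (measure_ne_top μ _)).comp ht
  obtain ⟨n, hn⟩ := (ht'.eventually_const_lt ha).exists
  exact ⟨L n, fun w hw => ((hL _ _).1 hw).2, hn⟩

end Words

/-! ### Semidecidable inequalities between computable reals. -/

section Comparison

variable {α : Type*} [Primcodable α]

theorem REPred.computable_lt {f g : α → ℕ} (hf : Computable f) (hg : Computable g) :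
    REPred fun a => f a < g a :=
  (PrimrecPred.rePred (p := fun x : ℕ × ℕ => x.1 < x.2) Primrec.nat_lt).comp_computable
    (hf.pair hg)

theorem REPred.computable_eq {β : Type*} [Primcodable β] {f g : α → β} (hf : Computable f)
    (hg : Computable g) : REPred fun a => f a = g a := by
  classical
  exact (PrimrecPred.rePred (p := fun x : β × β => x.1 = x.2) Primrec.eq).comp_computable
    (hf.pair hg)

theorem Primrec.nat_pow : Primrec₂ fun a b : ℕ => a ^ b :=
  Primrec₂.unpaired'.1 Nat.Primrec.pow

/-- Strict lower bounds of computable real numbers are recursively enumerable. -/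
theorem IsUniformlyComputable.rePred_lt {x : α → ℝ} (hx : IsUniformlyComputable x) :
    REPred fun y : α × ℕ × ℕ × ℕ => (y.2.2.2 : ℝ) < y.2.1 * x y.1 + y.2.2.1 := by
  obtain ⟨p, q, r, hp, hq, hr, h⟩ := hx
  have ha : Computable fun z : (α × ℕ × ℕ × ℕ) × ℕ => z.1.1 := Computable.fst.comp Computable.fst
  have hs : Computable fun z : (α × ℕ × ℕ × ℕ) × ℕ => z.1.2.1 :=
    Computable.fst.comp (Computable.snd.comp Computable.fst)
  have ht : Computable fun z : (α × ℕ × ℕ × ℕ) × ℕ => z.1.2.2.1 :=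
    Computable.fst.comp (Computable.snd.comp (Computable.snd.comp Computable.fst))
  have hu : Computable fun z : (α × ℕ × ℕ × ℕ) × ℕ => z.1.2.2.2 :=
    Computable.snd.comp (Computable.snd.comp (Computable.snd.comp Computable.fst))
  have hadd {f g : (α × ℕ × ℕ × ℕ) × ℕ → ℕ} (hf : Computable f) (hg : Computable g) :
    Computable fun z => f z + g z := Primrec.nat_add.to_comp.comp hf hg
  have hmul {f g : (α × ℕ × ℕ × ℕ) × ℕ → ℕ} (hf : Computable f) (hg : Computable g) :
    Computable fun z => f z * g z := Primrec.nat_mul.to_comp.comp hf hg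
  have h2 : Computable fun z : (α × ℕ × ℕ × ℕ) × ℕ => 2 ^ z.2 :=
    Primrec.nat_pow.to_comp.comp (Computable.const 2) Computable.snd
  have hp' := hp.comp ha Computable.snd
  have hq' := hq.comp ha Computable.snd
  have hr' := hadd (hr.comp ha Computable.snd) (Computable.const 1)
  -- This says that `u` lies below `s` times (approximation minus `2⁻ⁱ`) plus `t`, with denominators
  -- cleared and negative terms moved across so that only natural numbers occur.
  have key := REPred.computable_lt
    (hadd (hmul (hmul hu hr') h2) (hadd (hmul (hmul hs hq') h2) (hmul hs hr')))
    (hadd (hmul (hmul hs hp') h2) (hmul (hmul ht hr') h2))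
  refine key.exists_snd.of_eq fun y => ?_
  obtain ⟨a, s, t, u⟩ := y
  have equiv : ∀ i : ℕ, (u * (r a i + 1) * 2 ^ i + (s * q a i * 2 ^ i + s * (r a i + 1)) <
      s * p a i * 2 ^ i + t * (r a i + 1) * 2 ^ i) ↔
      (u : ℝ) < s * (((p a i : ℝ) - q a i) / (r a i + 1) - (1 / 2) ^ i) + t := by
    intro i
    have hr0 : (0 : ℝ) < (r a i : ℝ) + 1 := by positivity
    have h20 : (0 : ℝ) < 2 ^ i := by positivity
    rw [← Nat.cast_lt (α := ℝ)]
    conv_rhs => rw [← mul_lt_mul_iff_left₀ (mul_pos hr0 h20)]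
    have : (s * (((p a i : ℝ) - q a i) / (r a i + 1) - (1 / 2) ^ i) + t) *
        ((r a i + 1) * 2 ^ i) = s * p a i * 2 ^ i + t * (r a i + 1) * 2 ^ i
          - (s * q a i * 2 ^ i + s * (r a i + 1)) := by
      rw [one_div, inv_pow]; field_simp; ring
    rw [this]
    push_cast
    constructor <;> intro h <;> linarith
  simp only [equiv]
  have hs0 : (0 : ℝ) ≤ s := s.cast_nonneg
  constructor
  · rintro ⟨i, hi⟩
    have := mul_le_mul_of_nonneg_left (abs_lt.1 (h a i)).2.le hs0
    linarith
  · intro hlt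
    change (u : ℝ) < s * x a + t at hlt
    have ht : Tendsto (fun i : ℕ => s * (2 * (1 / 2 : ℝ) ^ i)) atTop (nhds (s * (2 * 0))) :=
      ((tendsto_pow_atTop_nhds_zero_of_lt_one (by norm_num) (by norm_num)).const_mul 2).const_mul _
    obtain ⟨i, hi⟩ := (ht.eventually_lt_const (u := s * x a + t - u) (by linarith)).exists
    refine ⟨i, ?_⟩
    have := mul_le_mul_of_nonneg_left (abs_lt.1 (h a i)).1.le hs0
    linarith

end Comparison

/-! ### The averaging inequality. -/

section AverageBound

/-- Integrate the counting function over `U`: each summand contributes at least `μ X`, while the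
function is at most `l.length * a` on `O` and trivially at most `l.length` off `O`. -/
theorem measureReal_le_of_sum_indicator_le {α ι : Type*} [MeasurableSpace α] {μ : Measure α}
    [IsFiniteMeasure μ] {l : List ι} (hl : l ≠ []) {A : ι → Set α}
    (hA : ∀ i, MeasurableSet (A i)) {O U X : Set α} (hO : MeasurableSet O)
    {a ε : ℝ} (ha : 0 ≤ a)
    (hle : ∀ x ∈ O, (l.map fun i => (A i).indicator (fun _ => (1 : ℝ)) x).sum ≤ l.length * a)
    (hOc : μ.real Oᶜ ≤ ε) (hX : ∀ i ∈ l, μ.real X ≤ μ.real (A i ∩ U)) :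
    μ.real X ≤ a * μ.real U + ε := by
  have hN : (0 : ℝ) < l.length := by exact_mod_cast List.length_pos_iff.2 hl
  have hint : ∀ l : List ι,
      Integrable (fun x => (l.map fun i => (A i).indicator (fun _ => (1 : ℝ)) x).sum)
        (μ.restrict U) ∧
      ∫ x in U, (l.map fun i => (A i).indicator (fun _ => (1 : ℝ)) x).sum ∂μ =
        (l.map fun i => μ.real (A i ∩ U)).sum := by
    intro l
    induction l with
    | nil => simp
    | cons i l ih =>
      have hi : Integrable ((A i).indicator fun _ => (1 : ℝ)) (μ.restrict U) :=
        (integrable_const 1).indicator (hA i)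
      simp only [List.map_cons, List.sum_cons]
      refine ⟨hi.add ih.1, ?_⟩
      rw [integral_add hi ih.1, ih.2, integral_indicator (hA i)]
      simp [measureReal_restrict_apply, hA i, Measure.restrict_restrict]
  have hle' : ∀ l : List ι, ∀ x,
      (l.map fun i => (A i).indicator (fun _ => (1 : ℝ)) x).sum ≤ l.length := by
    intro l x
    refine (List.sum_le_card_nsmul _ 1 ?_).trans (by simp)
    simp only [List.mem_map]
    rintro _ ⟨i, -, rfl⟩
    exact Set.indicator_le_self' (fun _ _ => zero_le_one) x
  have hOi : Integrable (Oᶜ.indicator fun _ => (l.length : ℝ)) (μ.restrict U) :=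
    (integrable_const _).indicator hO.compl
  have h1 : (l.map fun i => μ.real (A i ∩ U)).sum ≤
      ∫ x in U, (l.length * a + Oᶜ.indicator (fun _ => (l.length : ℝ)) x) ∂μ := by
    rw [← (hint l).2]
    refine integral_mono (hint l).1 ((integrable_const _).add hOi) fun x => ?_
    by_cases hx : x ∈ O
    · simpa [hx] using hle x hx
    · simp only [Set.mem_compl_iff, hx, not_false_eq_true, Set.indicator_of_mem]
      have := hle' l x
      have := mul_nonneg hN.le ha
      linarith
  have h2 : (l.length : ℝ) * μ.real X ≤ (l.map fun i => μ.real (A i ∩ U)).sum := by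
    have := List.card_nsmul_le_sum (l.map fun i => μ.real (A i ∩ U)) (μ.real X) (by
      simp only [List.mem_map]
      rintro _ ⟨i, hi, rfl⟩
      exact hX i hi)
    simpa using this
  rw [integral_add (integrable_const _) hOi, integral_indicator hO.compl] at h1
  have h3 : (μ.restrict U).real Oᶜ ≤ ε :=
    (ENNReal.toReal_mono (measure_ne_top _ _) (Measure.restrict_apply_le _ _)).trans hOc
  simp only [integral_const, smul_eq_mul, measureReal_restrict_apply_univ] at h1
  have h4 : (μ.restrict U).real Oᶜ * l.length ≤ ε * l.length :=
    mul_le_mul_of_nonneg_right h3 hN.le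
  refine le_of_mul_le_mul_left ?_ hN
  calc (l.length : ℝ) * μ.real X ≤ _ := h2.trans h1
    _ ≤ μ.real U * (l.length * a) + ε * l.length := by gcongr
    _ = l.length * (a * μ.real U + ε) := by ring

end AverageBound

/-! ### Certified averaging lists: enumerability, contraction and existence. -/

section AveragingList

/-- The cylinder of `v` is recognized to be mapped by `h` into the complement of the cylinder of
`w`. -/
def AvoidsCylinder (E : Set (ℕ × List Bool × List Bool)) (h : ℕ) (w v : List Bool) : Prop :=
  ∃ z v', (z.length = w.length ∧ z ≠ w ∧ v.take v'.length = v') ∧ (h, z, v') ∈ E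

open Classical in
/-- A list of pairs `(g⁻¹, g)` such that the average number of `g` in the list for which `g • x`
lies in `[w]` is recognized to be less than `μ [w] + 2⁻ᵏ` for all `x` outside a set of measure less
than `2⁻ᵏ`. -/
def IsAveragingList (Γ : Set ℕ) [Group Γ] (E : Set (ℕ × List Bool × List Bool))
    (μ : Measure (ℕ → Bool)) (k : ℕ) (w : List Bool) (F : List (ℕ × ℕ)) : Prop :=
  (∀ b ∈ F, ∃ g : Γ, b = (((g⁻¹ : Γ) : ℕ), (g : ℕ))) ∧
  ∃ (B : ℕ) (G : List (List Bool)),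
    (∀ v ∈ G, B ≤ F.countP fun b => decide (AvoidsCylinder E b.2 w v)) ∧
    (2 : ℝ) ^ k < 2 ^ k * μ.real (⋃ v ∈ G, wordCylinder v) + 1 ∧
    (F.length : ℝ) * 2 ^ k <
      F.length * 2 ^ k * μ.real (wordCylinder w) + (F.length + B * 2 ^ k)

theorem REPred.avoidsCylinder {E : Set (ℕ × List Bool × List Bool)}
    (hE : REPred fun t => t ∈ E) :
    REPred fun t : ℕ × List Bool × List Bool => AvoidsCylinder E t.1 t.2.1 t.2.2 := by
  let τ := ((ℕ × List Bool × List Bool) × List Bool) × List Bool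
  have hh : Primrec fun t : τ => t.1.1.1 := Primrec.fst.comp (Primrec.fst.comp Primrec.fst)
  have hw : Primrec fun t : τ => t.1.1.2.1 :=
    Primrec.fst.comp (Primrec.snd.comp (Primrec.fst.comp Primrec.fst))
  have hv : Primrec fun t : τ => t.1.1.2.2 :=
    Primrec.snd.comp (Primrec.snd.comp (Primrec.fst.comp Primrec.fst))
  have hz : Primrec fun t : τ => t.1.2 := Primrec.snd.comp Primrec.fst
  have hv' : Primrec fun t : τ => t.2 := Primrec.snd
  have h1 : PrimrecPred fun t : τ => t.1.2.length = t.1.1.2.1.length ∧ t.1.2 ≠ t.1.1.2.1 ∧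
      t.1.1.2.2.take t.2.length = t.2 :=
    (Primrec.eq.comp (Primrec.list_length.comp hz) (Primrec.list_length.comp hw)).and
      ((Primrec.eq.comp hz hw).not.and
        (Primrec.eq.comp (Primrec.list_take.comp (Primrec.list_length.comp hv') hv) hv'))
  exact (h1.rePred.and (hE.comp_computable (hh.pair (hz.pair hv')).to_comp)).exists_snd.exists_snd

theorem REPred.isAveragingList {Γ : Set ℕ} [Group Γ] (hΓ : IsComputableGroup Γ)
    {E : Set (ℕ × List Bool × List Bool)} (hE : REPred fun t => t ∈ E)
    {μ : Measure (ℕ → Bool)} (hμ : IsComputableMeasure μ) :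
    REPred fun t : (ℕ × List Bool) × List (ℕ × ℕ) => IsAveragingList Γ E μ t.1.1 t.1.2 t.2 := by
  classical
  obtain ⟨hmem, m, hm, hmul⟩ := hΓ
  -- Carrying both elements of the pair means that inverses need only be checked, by multiplying to
  -- `1`.
  have hpair : REPred fun b : ℕ × ℕ => ∃ g : Γ, b = (((g⁻¹ : Γ) : ℕ), (g : ℕ)) := by
    have h1 := (hmem.to_re.comp_computable Computable.fst).and
      ((hmem.to_re.comp_computable Computable.snd).and
      (REPred.computable_eq (hm.comp Computable.fst Computable.snd)
        (Computable.const (((1 : Γ) : ℕ)))))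
    refine h1.of_eq fun b => ⟨?_, ?_⟩
    · rintro ⟨h1, h2, h3⟩
      have h4 : (⟨b.1, h1⟩ : Γ) * ⟨b.2, h2⟩ = 1 := Subtype.ext ((hmul _ _).symm.trans h3)
      refine ⟨⟨b.2, h2⟩, ?_⟩
      rw [← eq_inv_of_mul_eq_one_left h4]
    · rintro ⟨g, rfl⟩
      refine ⟨(g⁻¹ : Γ).2, g.2, ?_⟩
      have := hmul g⁻¹ g
      rwa [inv_mul_cancel] at this
  have h1 : REPred fun t : (ℕ × List Bool) × List (ℕ × ℕ) =>
      ∀ b ∈ t.2, ∃ g : Γ, b = (((g⁻¹ : Γ) : ℕ), (g : ℕ)) :=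
    (hpair.comp_computable Computable.snd).forall_mem_list
  let τ := (((ℕ × List Bool) × List (ℕ × ℕ)) × ℕ) × List (List Bool)
  have hk : Primrec fun t : τ => 2 ^ t.1.1.1.1 := Primrec.nat_pow.comp (Primrec.const 2)
    (Primrec.fst.comp (Primrec.fst.comp (Primrec.fst.comp Primrec.fst)))
  have hw : Primrec fun t : τ => t.1.1.1.2 :=
    Primrec.snd.comp (Primrec.fst.comp (Primrec.fst.comp Primrec.fst))
  have hF : Primrec fun t : τ => t.1.1.2 := Primrec.snd.comp (Primrec.fst.comp Primrec.fst)
  have hN : Primrec fun t : τ => t.1.1.2.length := Primrec.list_length.comp hF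
  have hB : Primrec fun t : τ => t.1.2 := Primrec.snd.comp Primrec.fst
  have hcount : REPred fun t : τ =>
      ∀ v ∈ t.2, t.1.2 ≤ t.1.1.2.countP fun b => decide (AvoidsCylinder E b.2 t.1.1.1.2 v) := by
    have h2 := (hE.avoidsCylinder.comp_computable
      (f := fun y : (List Bool × List Bool) × ℕ × ℕ => (y.2.2, y.1.1, y.1.2))
      (Primrec.to_comp ((Primrec.snd.comp Primrec.snd).pair
        ((Primrec.fst.comp Primrec.fst).pair (Primrec.snd.comp Primrec.fst))))).le_countP
    have h3 := (h2.comp_computable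
      (f := fun y : (List Bool × List (ℕ × ℕ) × ℕ) × List Bool => ((y.1.1, y.2), y.1.2))
      (Primrec.to_comp (((Primrec.fst.comp Primrec.fst).pair Primrec.snd).pair
        (Primrec.snd.comp Primrec.fst)))).forall_mem_list
    exact h3.comp_computable (f := fun t : τ => ((t.1.1.1.2, t.1.1.2, t.1.2), t.2))
      ((hw.pair (hF.pair hB)).pair Primrec.snd).to_comp
  have hlt := IsUniformlyComputable.rePred_lt hμ
  have h4 := hlt.comp_computable
    (f := fun t : τ => (t.2, 2 ^ t.1.1.1.1, 1, 2 ^ t.1.1.1.1))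
    (Primrec.snd.pair (hk.pair ((Primrec.const 1).pair hk))).to_comp
  have h5 := hlt.comp_computable
    (f := fun t : τ => ([t.1.1.1.2], t.1.1.2.length * 2 ^ t.1.1.1.1,
      t.1.1.2.length + t.1.2 * 2 ^ t.1.1.1.1, t.1.1.2.length * 2 ^ t.1.1.1.1))
    (((Primrec.list_cons.comp hw (Primrec.const []))).pair
      ((Primrec.nat_mul.comp hN hk).pair ((Primrec.nat_add.comp hN
        (Primrec.nat_mul.comp hB hk)).pair (Primrec.nat_mul.comp hN hk)))).to_comp
  refine (h1.and (hcount.and (h4.and h5)).exists_snd.exists_snd).of_eq fun t => ?_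
  simp [IsAveragingList]

variable {Γ : Set ℕ} [Group Γ] [MulAction Γ (ℕ → Bool)] {E : Set (ℕ × List Bool × List Bool)}
  {μ : Measure (ℕ → Bool)} [IsProbabilityMeasure μ]

theorem AvoidsCylinder.smul_notMem
    (hE : ∀ (g : Γ) (w : List Bool), (fun ω : ℕ → Bool => g • ω) ⁻¹' wordCylinder w =
      ⋃ v ∈ {v | ((g : ℕ), w, v) ∈ E}, wordCylinder v)
    {g : Γ} {w v : List Bool} (h : AvoidsCylinder E g w v) {x : ℕ → Bool}
    (hx : x ∈ wordCylinder v) : g • x ∉ wordCylinder w := by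
  obtain ⟨z, v', ⟨hl, hne, ht⟩, hz⟩ := h
  intro hw
  have hxz : x ∈ (fun ω : ℕ → Bool => g • ω) ⁻¹' wordCylinder z := by
    rw [hE]
    exact Set.mem_biUnion hz (wordCylinder_subset_of_take ht hx)
  exact hne (eq_of_mem_wordCylinder_of_length_eq hxz hw hl)

/-- The prefix of `g • x` of length `w.length` differs from `w`, and its cylinder has an open
preimage, so a finite prefix of `x` already certifies the miss. -/
theorem eventually_avoidsCylinder
    (hE : ∀ (g : Γ) (w : List Bool), (fun ω : ℕ → Bool => g • ω) ⁻¹' wordCylinder w =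
      ⋃ v ∈ {v | ((g : ℕ), w, v) ∈ E}, wordCylinder v)
    {g : Γ} {w : List Bool} {x : ℕ → Bool} (hx : g • x ∉ wordCylinder w) :
    ∀ᶠ n in atTop, AvoidsCylinder E g w (prefixWord x n) := by
  have hxz : x ∈ (fun ω : ℕ → Bool => g • ω) ⁻¹' wordCylinder (prefixWord (g • x) w.length) :=
    mem_wordCylinder_prefixWord _ _
  rw [hE] at hxz
  obtain ⟨v, hv, hxv⟩ := Set.mem_iUnion₂.1 hxz
  filter_upwards [eventually_ge_atTop v.length] with n hn
  refine ⟨_, v, ⟨by simp, fun h => hx (mem_wordCylinder_iff.2 h), ?_⟩, hv⟩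
  exact take_eq_of_mem_wordCylinder hxv (mem_wordCylinder_prefixWord x n) (by simpa)

theorem list_sum_indicator_eq_countP {ι α : Type*} (l : List ι) (A : ι → Set α) (x : α)
    [∀ i, Decidable (x ∈ A i)] :
    (l.map fun i => (A i).indicator (fun _ => (1 : ℝ)) x).sum =
      l.countP fun i => decide (x ∈ A i) := by
  induction l with
  | nil => simp
  | cons i l ih =>
    by_cases h : x ∈ A i
    · simp [ih, h, add_comm]
    · simp [ih, h]

theorem IsAveragingList.measureReal_inter_le [SMulInvariantMeasure Γ (ℕ → Bool) μ]
    [MeasurableConstSMul Γ (ℕ → Bool)]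
    (hE : ∀ (g : Γ) (w : List Bool), (fun ω : ℕ → Bool => g • ω) ⁻¹' wordCylinder w =
      ⋃ v ∈ {v | ((g : ℕ), w, v) ∈ E}, wordCylinder v)
    {k : ℕ} {w : List Bool} {F : List (ℕ × ℕ)} (hF : IsAveragingList Γ E μ k w F)
    {U X : Set (ℕ → Bool)} (hU : MeasurableSet U) (hXw : X ⊆ wordCylinder w)
    (hX : ∀ b ∈ F, ∀ g : Γ, (g : ℕ) = b.1 → ∀ x ∈ X, g • x ∈ U) :
    μ.real X ≤ μ.real U * μ.real (wordCylinder w) + 2 * (1 / 2) ^ k := by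
  classical
  obtain ⟨hinv, B, G, hG, hGμ, hB⟩ := hF
  obtain ⟨l, rfl⟩ : ∃ l : List Γ, F = l.map fun g => (((g⁻¹ : Γ) : ℕ), (g : ℕ)) := by
    clear hX hG hB
    induction F with
    | nil => exact ⟨[], rfl⟩
    | cons b F ih =>
      obtain ⟨l, hl⟩ := ih fun c hc => hinv c (List.mem_cons_of_mem _ hc)
      obtain ⟨g, hg⟩ := hinv b List.mem_cons_self
      exact ⟨g :: l, by rw [hg, hl]; rfl⟩
  have h2k : (0 : ℝ) < 2 ^ k := by positivity
  have hk : ((1 : ℝ) / 2) ^ k * 2 ^ k = 1 := by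
    rw [← mul_pow]; norm_num
  simp only [List.length_map] at hB
  have hO : MeasurableSet (⋃ v ∈ G, wordCylinder v) :=
    measurableSet_biUnion_wordCylinder {v | v ∈ G}
  -- For an empty list the last inequality forces `B > 0`, no word can then reach the count `B`, and
  -- an empty `G` violates the measure condition.
  have hl : l ≠ [] := by
    rintro rfl
    have hB0 : B ≠ 0 := by rintro rfl; simp at hB
    have : G = [] := List.eq_nil_iff_forall_not_mem.2 fun v hv => hB0 (by simpa using hG v hv)
    rw [this] at hGμ
    have := one_le_pow₀ (M₀ := ℝ) one_le_two (n := k)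
    simp at hGμ
    linarith
  have key := measureReal_le_of_sum_indicator_le (μ := μ) hl
    (A := fun g : Γ => (fun x => g • x) ⁻¹' wordCylinder w)
    (fun g => (measurable_const_smul g) (measurableSet_wordCylinder w))
    (X := X) (U := U) hO (a := μ.real (wordCylinder w) + (1 / 2) ^ k) (by positivity)
    (ε := (1 / 2) ^ k) ?_ ?_ ?_
  · have hU1 : μ.real U ≤ 1 := measureReal_le_one
    have : (1 / 2 : ℝ) ^ k * μ.real U ≤ (1 / 2) ^ k * 1 := by gcongr
    linarith
  · intro x hx
    rw [list_sum_indicator_eq_countP]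
    obtain ⟨v, hv, hxv⟩ := Set.mem_iUnion₂.1 hx
    have h1 := hG v hv
    rw [List.countP_map] at h1
    have h2 : l.countP ((fun b : ℕ × ℕ => decide (AvoidsCylinder E b.2 w v)) ∘
        fun g : Γ => (((g⁻¹ : Γ) : ℕ), (g : ℕ))) ≤
        l.countP fun g => !decide (x ∈ (fun x => g • x) ⁻¹' wordCylinder w) := by
      refine List.countP_mono_left fun g _ hg => ?_
      have hg : AvoidsCylinder E g w v := by simpa using hg
      simpa using hg.smul_notMem hE hxv
    have h3 := List.length_eq_countP_add_countP
      (fun g : Γ => decide (x ∈ (fun x => g • x) ⁻¹' wordCylinder w)) (l := l)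
    have h4 : (l.countP fun g : Γ => decide (x ∈ (fun x => g • x) ⁻¹' wordCylinder w)) + B ≤
        l.length := by
      rw [h3]
      refine Nat.add_le_add_left (h1.trans (h2.trans (le_of_eq ?_))) _
      congr 1; ext g; simp
    have h5 : ((l.countP fun g : Γ => decide (x ∈ (fun x => g • x) ⁻¹' wordCylinder w) : ℕ) : ℝ)
        + B ≤ l.length := by exact_mod_cast h4
    have h6 : (l.length : ℝ) * 2 ^ k < (l.length * (μ.real (wordCylinder w) + (1 / 2) ^ k) + B)
        * 2 ^ k := by
      calc _ < _ := hB
        _ = l.length * 2 ^ k * μ.real (wordCylinder w) +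
          (l.length * ((1 / 2) ^ k * 2 ^ k) + B * 2 ^ k) := by rw [hk, mul_one]
        _ = _ := by ring
    have h7 := lt_of_mul_lt_mul_right h6 h2k.le
    linarith
  · rw [probReal_compl_eq_one_sub hO]
    refine le_of_mul_le_mul_right ?_ h2k
    rw [hk]
    linarith
  -- The map `g⁻¹` sends `X` into `U`, and into the preimage of `[w]` under `g` because `X ⊆ [w]`;
  -- invariance of `μ` then compares the measures.
  · intro g hg
    refine (measureReal_mono (fun x hx => ?_ : X ⊆
      (fun x => g⁻¹ • x) ⁻¹' ((fun x => g • x) ⁻¹' wordCylinder w ∩ U))).trans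
      (le_of_eq ?_)
    · refine ⟨?_, hX _ (List.mem_map.2 ⟨g, hg, rfl⟩) g⁻¹ rfl x hx⟩
      simpa using hXw hx
    · rw [measureReal_def, measure_preimage_smul_of_nullMeasurableSet, measureReal_def]
      exact (((measurable_const_smul g) (measurableSet_wordCylinder w)).inter
        hU).nullMeasurableSet

theorem exists_isAveragingList [ErgodicSMul Γ (ℕ → Bool) μ] [MeasurableConstSMul Γ (ℕ → Bool)]
    (hE : ∀ (g : Γ) (w : List Bool), (fun ω : ℕ → Bool => g • ω) ⁻¹' wordCylinder w =
      ⋃ v ∈ {v | ((g : ℕ), w, v) ∈ E}, wordCylinder v)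
    (k : ℕ) (w : List Bool) : ∃ F, IsAveragingList Γ E μ k w F := by
  classical
  have h2k : (0 : ℝ) < 2 ^ k := by positivity
  have hk : ((1 : ℝ) / 2) ^ k * 2 ^ k = 1 := by
    rw [← mul_pow]; norm_num
  obtain ⟨l, hl, hμ⟩ := ErgodicSMul.exists_list_average_lt (G := Γ) (μ := μ)
    (measurableSet_wordCylinder w) (ε := (1 / 2) ^ k) (by positivity)
  have hN : (0 : ℝ) < l.length := by exact_mod_cast List.length_pos_iff.2 hl
  set a : ℝ := μ.real (wordCylinder w) + (1 / 2) ^ k with ha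
  have ha0 : 0 < a := by positivity
  -- `B` is the least number of misses that pushes the average of hits strictly below `a`;
  -- minimality makes every point with average below `a` have at least `B` misses.
  have hex : ∃ n : ℕ, (l.length : ℝ) < l.length * a + n :=
    ⟨l.length, by have := mul_pos hN ha0; linarith⟩
  obtain ⟨B, hB, hmin⟩ : ∃ B : ℕ, (l.length : ℝ) < l.length * a + B ∧
      ∀ n : ℕ, (l.length : ℝ) < l.length * a + n → B ≤ n :=
    ⟨Nat.find hex, Nat.find_spec hex, fun n hn => Nat.find_min' hex hn⟩
  set F := l.map fun g : Γ => (((g⁻¹ : Γ) : ℕ), (g : ℕ)) with hF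
  let S : Set (List Bool) := {v | B ≤ F.countP fun b => decide (AvoidsCylinder E b.2 w v)}
  have hsub : (⋃ v ∈ S, wordCylinder v)ᶜ ⊆ {x | a ≤ (l.length : ℝ)⁻¹ *
      (l.map fun g => (wordCylinder w).indicator (fun _ => (1 : ℝ)) (g • x)).sum} := by
    intro x hx
    by_contra hlt
    refine hx ?_
    have hlt : (l.length : ℝ)⁻¹ *
      (l.map fun g => (wordCylinder w).indicator (fun _ => (1 : ℝ)) (g • x)).sum < a :=
      not_le.1 hlt
    have h0 : (l.map fun g : Γ => (wordCylinder w).indicator (fun _ => (1 : ℝ)) (g • x)).sum =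
        l.countP fun g : Γ => decide (x ∈ (fun x => g • x) ⁻¹' wordCylinder w) :=
      list_sum_indicator_eq_countP l (fun g : Γ => (fun x => g • x) ⁻¹' wordCylinder w) x
    rw [h0, inv_mul_lt_iff₀ hN] at hlt
    have h3 := List.length_eq_countP_add_countP
      (fun g : Γ => decide (x ∈ (fun x => g • x) ⁻¹' wordCylinder w)) (l := l)
    have h4 : B ≤ l.countP fun g : Γ => ¬ decide (x ∈ (fun x => g • x) ⁻¹' wordCylinder w) := by
      refine hmin _ ?_
      have : (l.length : ℝ) = _ := congrArg Nat.cast h3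
      push_cast at this
      linarith
    -- Finitely many elements, so one prefix length certifies all misses at once.
    have h5 : ∀ l' : List Γ, ∀ᶠ n in atTop, ∀ g ∈ l', g • x ∉ wordCylinder w →
        AvoidsCylinder E g w (prefixWord x n) := by
      intro l'
      induction l' with
      | nil => simp
      | cons g l' ih =>
        have : ∀ᶠ n in atTop, g • x ∉ wordCylinder w →
            AvoidsCylinder E g w (prefixWord x n) := by
          by_cases hg : g • x ∈ wordCylinder w
          · exact Eventually.of_forall fun n h => absurd hg h
          · exact (eventually_avoidsCylinder hE hg).mono fun n h _ => h
        filter_upwards [ih, this] with n h1 h2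
        exact List.forall_mem_cons.2 ⟨h2, h1⟩
    obtain ⟨n, hn⟩ := (h5 l).exists
    refine Set.mem_biUnion (x := prefixWord x n) ?_ (mem_wordCylinder_prefixWord x n)
    change B ≤ F.countP fun b => decide (AvoidsCylinder E b.2 w (prefixWord x n))
    rw [hF, List.countP_map]
    refine h4.trans (List.countP_mono_left fun g hg hgx => ?_)
    exact decide_eq_true (hn g hg (by simpa using hgx))
  have hS := (measureReal_mono (μ := μ) hsub).trans_lt hμ
  rw [probReal_compl_eq_one_sub (measurableSet_biUnion_wordCylinder S)] at hS
  obtain ⟨G, hG, hGμ⟩ := exists_list_lt_measureReal μ S (a := 1 - (1 / 2) ^ k) (by linarith)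
  refine ⟨F, ?_, B, G, hG, ?_, ?_⟩
  · intro b hb
    obtain ⟨g, -, rfl⟩ := List.mem_map.1 hb
    exact ⟨g, rfl⟩
  · have := mul_lt_mul_of_pos_right hGμ h2k
    rw [sub_mul, hk] at this
    linarith
  · have hlen : F.length = l.length := by simp [hF]
    rw [hlen]
    have := mul_lt_mul_of_pos_right hB h2k
    calc (l.length : ℝ) * 2 ^ k < _ := this
      _ = l.length * 2 ^ k * μ.real (wordCylinder w) +
          (l.length * ((1 / 2) ^ k * 2 ^ k) + B * 2 ^ k) := by rw [ha]; ring
      _ = _ := by rw [hk, mul_one]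

end AveragingList

/-! ### Disjoint cylinders exhausting the surviving part of a cylinder. -/

section ChildWords

/-- The word `u` extends `w`, and within `|u|` steps of computation the cylinder of `u` is
recognized to lie in the open set described by `r` for all group elements in the list `F`. -/
def IsInside (r : ℕ × List Bool → ℕ → Prop) (F : List (ℕ × ℕ)) (w u : List Bool) : Prop :=
  u.take w.length = w ∧ ∀ b ∈ F, ∃ i ∈ List.range (u.length + 1),
    ∃ n ∈ List.range (u.length + 1), r (b.1, u.take i) n

/-- The words `u` that are minimal with `IsInside r F w u`. -/
def IsChild (r : ℕ × List Bool → ℕ → Prop) (F : List (ℕ × ℕ)) (w u : List Bool) : Prop :=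
  IsInside r F w u ∧ ∀ i ∈ List.range u.length, ¬ IsInside r F w (u.take i)

theorem primrecPred_isInside {r : ℕ × List Bool → ℕ → Prop} (hr : PrimrecRel r) :
    PrimrecPred fun t : List (ℕ × ℕ) × List Bool × List Bool => IsInside r t.1 t.2.1 t.2.2 := by
  have h1 : PrimrecRel fun (n : ℕ) (y : ℕ × (ℕ × ℕ) × List Bool) =>
      r (y.2.1.1, y.2.2.take y.1) n :=
    hr.comp ((Primrec.fst.comp (Primrec.fst.comp (Primrec.snd.comp Primrec.snd))).pair
      (Primrec.list_take.comp (Primrec.fst.comp Primrec.snd)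
        (Primrec.snd.comp (Primrec.snd.comp Primrec.snd)))) Primrec.fst
  have hrange : Primrec fun u : List Bool => List.range (u.length + 1) :=
    Primrec.list_range.comp (Primrec.succ.comp Primrec.list_length)
  have h2 : PrimrecPred fun y : ℕ × (ℕ × ℕ) × List Bool =>
      ∃ n ∈ List.range (y.2.2.length + 1), r (y.2.1.1, y.2.2.take y.1) n :=
    h1.exists_mem_list.comp (hrange.comp (Primrec.snd.comp Primrec.snd)) Primrec.id
  have h3 : PrimrecPred fun y : (ℕ × ℕ) × List Bool => ∃ i ∈ List.range (y.2.length + 1),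
      ∃ n ∈ List.range (y.2.length + 1), r (y.1.1, y.2.take i) n :=
    PrimrecRel.comp (PrimrecRel.exists_mem_list
      (R := fun (i : ℕ) (y : (ℕ × ℕ) × List Bool) =>
        ∃ n ∈ List.range (y.2.length + 1), r (y.1.1, y.2.take i) n) h2.primrecRel)
      (hrange.comp Primrec.snd) Primrec.id
  have h4 : PrimrecPred fun t : List (ℕ × ℕ) × List Bool × List Bool =>
      ∀ b ∈ t.1, ∃ i ∈ List.range (t.2.2.length + 1),
        ∃ n ∈ List.range (t.2.2.length + 1), r (b.1, t.2.2.take i) n :=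
    PrimrecRel.comp (PrimrecRel.forall_mem_list
      (R := fun (b : ℕ × ℕ) (u : List Bool) => ∃ i ∈ List.range (u.length + 1),
        ∃ n ∈ List.range (u.length + 1), r (b.1, u.take i) n) h3.primrecRel)
      Primrec.fst (Primrec.snd.comp Primrec.snd)
  exact (Primrec.eq.comp (Primrec.list_take.comp
    (Primrec.list_length.comp (Primrec.fst.comp Primrec.snd)) (Primrec.snd.comp Primrec.snd))
    (Primrec.fst.comp Primrec.snd)).and h4

theorem primrecPred_isChild {r : ℕ × List Bool → ℕ → Prop} (hr : PrimrecRel r) :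
    PrimrecPred fun t : List (ℕ × ℕ) × List Bool × List Bool => IsChild r t.1 t.2.1 t.2.2 := by
  have h := primrecPred_isInside hr
  have h1 : PrimrecRel fun (i : ℕ) (t : List (ℕ × ℕ) × List Bool × List Bool) =>
      ¬ IsInside r t.1 t.2.1 (t.2.2.take i) :=
    (h.comp (f := fun y : ℕ × List (ℕ × ℕ) × List Bool × List Bool =>
        (y.2.1, y.2.2.1, y.2.2.2.take y.1))
      ((Primrec.fst.comp Primrec.snd).pair
        ((Primrec.fst.comp (Primrec.snd.comp Primrec.snd)).pair
          (Primrec.list_take.comp Primrec.fst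
            (Primrec.snd.comp (Primrec.snd.comp Primrec.snd)))))).not
  exact h.and (h1.forall_mem_list.comp (Primrec.list_range.comp
    (Primrec.list_length.comp (Primrec.snd.comp Primrec.snd))) Primrec.id)

variable {r : ℕ × List Bool → ℕ → Prop} {F : List (ℕ × ℕ)} {w : List Bool}

/-- Cylinders that meet are nested, and a child cannot be a proper prefix of another by minimality.
-/
theorem IsChild.disjoint {u v : List Bool} (hu : IsChild r F w u) (hv : IsChild r F w v)
    (h : u ≠ v) : Disjoint (wordCylinder u) (wordCylinder v) := by
  wlog hl : u.length ≤ v.length generalizing u v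
  · exact (this hv hu h.symm (le_of_not_ge hl)).symm
  rw [Set.disjoint_left]
  intro x hxu hxv
  have ht := take_eq_of_mem_wordCylinder hxu hxv hl
  rcases hl.eq_or_lt with he | hlt
  · exact h (eq_of_mem_wordCylinder_of_length_eq hxu hxv he)
  · refine hv.2 u.length (by simpa using hlt) ?_
    rw [ht]
    exact hu.1

/-- Long prefixes of `x` allow enough computation steps to confirm every membership; the shortest
prefix that succeeds is a child. -/
theorem exists_isChild {x : ℕ → Bool} (hx : x ∈ wordCylinder w)
    (hF : ∀ b ∈ F, ∃ v n, r (b.1, v) n ∧ x ∈ wordCylinder v) :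
    ∃ u, IsChild r F w u ∧ x ∈ wordCylinder u := by
  classical
  have hev : ∀ᶠ m in atTop, ∀ b ∈ F, ∃ i ∈ List.range (m + 1),
      ∃ n ∈ List.range (m + 1), r (b.1, (prefixWord x m).take i) n := by
    induction F with
    | nil => simp
    | cons b F ih =>
      obtain ⟨v, n, hr, hxv⟩ := hF b List.mem_cons_self
      filter_upwards [ih fun c hc => hF c (List.mem_cons_of_mem _ hc),
        eventually_ge_atTop v.length, eventually_ge_atTop n] with m h1 h2 h3
      refine List.forall_mem_cons.2 ⟨⟨v.length, by simp; omega, n, by simp; omega, ?_⟩, h1⟩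
      rwa [take_eq_of_mem_wordCylinder hxv (mem_wordCylinder_prefixWord x m) (by simpa)]
  have hex : ∃ m, IsInside r F w (prefixWord x m) := by
    obtain ⟨m, h1, h2⟩ := (hev.and (eventually_ge_atTop w.length)).exists
    refine ⟨m, take_eq_of_mem_wordCylinder hx (mem_wordCylinder_prefixWord x m) (by simpa), ?_⟩
    simpa only [length_prefixWord] using h1
  refine ⟨prefixWord x (Nat.find hex), ⟨Nat.find_spec hex, fun i hi h => ?_⟩,
    mem_wordCylinder_prefixWord _ _⟩
  rw [List.mem_range, length_prefixWord] at hi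
  rw [take_prefixWord, min_eq_left hi.le] at h
  exact Nat.find_min hex hi h

theorem IsChild.exists_mem {u : List Bool} (hu : IsChild r F w u) {x : ℕ → Bool}
    (hx : x ∈ wordCylinder u) {b : ℕ × ℕ} (hb : b ∈ F) :
    ∃ v n, r (b.1, v) n ∧ x ∈ wordCylinder v := by
  obtain ⟨i, -, n, -, h⟩ := hu.1.2 b hb
  exact ⟨_, n, h, wordCylinder_subset_take u i hx⟩

theorem IsChild.wordCylinder_subset {u : List Bool} (hu : IsChild r F w u) :
    wordCylinder u ⊆ wordCylinder w :=
  wordCylinder_subset_of_take hu.1.1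

end ChildWords

/-! ### Iterating the contraction over generations. -/

section Descendants

/-- The transitions from `(k, w)` to `(k + code of u + 2, u)` for the children `u` of `w` with
respect to the list `F (k, w)`. -/
def ChildStep (r : ℕ × List Bool → ℕ → Prop) (F : ℕ × List Bool → List (ℕ × ℕ))
    (s t : ℕ × List Bool) : Prop :=
  t.1 = s.1 + Encodable.encode t.2 + 2 ∧ IsChild r (F s) s.2 t.2

/-- The union of the cylinders of the descendants in the `n`th generation. -/
def descendantSet (r : ℕ × List Bool → ℕ → Prop) (F : ℕ × List Bool → List (ℕ × ℕ)) (n : ℕ)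
    (s : ℕ × List Bool) : Set (ℕ → Bool) :=
  ⋃ u ∈ {u | ∃ k, IterRel (ChildStep r F) n s (k, u)}, wordCylinder u

variable {r : ℕ × List Bool → ℕ → Prop} {F : ℕ × List Bool → List (ℕ × ℕ)}

theorem REPred.childStep (hr : PrimrecRel r) (hF : Computable F) :
    REPred fun x : (ℕ × List Bool) × (ℕ × List Bool) => ChildStep r F x.1 x.2 := by
  refine (REPred.computable_eq (Computable.fst.comp Computable.snd) ?_).and
    ((primrecPred_isChild hr).rePred.comp_computable
      (f := fun x : (ℕ × List Bool) × (ℕ × List Bool) => (F x.1, x.1.2, x.2.2))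
      ((hF.comp Computable.fst).pair ((Computable.snd.comp Computable.fst).pair
        (Computable.snd.comp Computable.snd))))
  exact (Primrec.nat_add.comp (Primrec.nat_add.comp (Primrec.fst.comp Primrec.fst)
    (Primrec.encode.comp (Primrec.snd.comp Primrec.snd))) (Primrec.const 2)).to_comp

theorem mem_descendantSet_succ {n k : ℕ} {w : List Bool} {x : ℕ → Bool} :
    x ∈ descendantSet r F (n + 1) (k, w) ↔ ∃ u, IsChild r (F (k, w)) w u ∧
      x ∈ descendantSet r F n (k + Encodable.encode u + 2, u) := by
  simp only [descendantSet, IterRel, ChildStep, Set.mem_iUnion, exists_prop, Set.mem_ofPred_eq]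
  constructor
  · rintro ⟨v, ⟨k', ⟨k'', u⟩, ⟨h1, hu⟩, h⟩, hx⟩
    obtain rfl : k'' = k + Encodable.encode u + 2 := h1
    exact ⟨u, hu, v, ⟨k', h⟩, hx⟩
  · rintro ⟨u, hu, v, ⟨k', h⟩, hx⟩
    exact ⟨v, ⟨k', _, ⟨rfl, hu⟩, h⟩, hx⟩

/-- The hypothesis on `x` will be supplied by its orbit staying in `U`; it yields a child containing
`x` in every generation. -/
theorem mem_descendantSet {x : ℕ → Bool}
    (hF : ∀ s, ∀ b ∈ F s, ∃ v n, r (b.1, v) n ∧ x ∈ wordCylinder v) (n k : ℕ) {w : List Bool}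
    (hx : x ∈ wordCylinder w) : x ∈ descendantSet r F n (k, w) := by
  induction n generalizing k w with
  | zero => exact Set.mem_biUnion (x := w) ⟨k, rfl⟩ hx
  | succ n ih =>
    obtain ⟨u, hu, hxu⟩ := exists_isChild hx (hF (k, w))
    exact mem_descendantSet_succ.2 ⟨u, hu, ih _ hxu⟩

theorem measure_descendantSet_le {μ : Measure (ℕ → Bool)} {a : ENNReal} (ha : a ≤ 1)
    (h : ∀ k w, μ (⋃ u ∈ {u | IsChild r (F (k, w)) w u}, wordCylinder u) ≤
      a * μ (wordCylinder w) + 2 * 2⁻¹ ^ k) (n k : ℕ) (w : List Bool) :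
    μ (descendantSet r F n (k, w)) ≤ a ^ n * μ (wordCylinder w) + 4 * 2⁻¹ ^ k := by
  induction n generalizing k w with
  | zero =>
    have : descendantSet r F 0 (k, w) ⊆ wordCylinder w := by
      intro x hx
      simp only [descendantSet, IterRel, Set.mem_iUnion, exists_prop, Set.mem_ofPred_eq] at hx
      obtain ⟨u, ⟨k', he⟩, hx⟩ := hx
      cases he
      exact hx
    calc μ (descendantSet r F 0 (k, w)) ≤ μ (wordCylinder w) := measure_mono this
      _ ≤ _ := by rw [pow_zero, one_mul]; exact le_self_add
  | succ n ih =>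
    set C : Set (List Bool) := {u | IsChild r (F (k, w)) w u}
    have h1 : descendantSet r F (n + 1) (k, w) ⊆
        ⋃ u ∈ C, descendantSet r F n (k + Encodable.encode u + 2, u) := by
      intro x hx
      obtain ⟨u, hu, hx⟩ := mem_descendantSet_succ.1 hx
      exact Set.mem_biUnion hu hx
    have h2 : ∑' u : C, μ (wordCylinder u) = μ (⋃ u ∈ C, wordCylinder u) :=
      (measure_biUnion C.to_countable (fun u hu v hv huv => hu.disjoint hv huv)
        fun u _ => measurableSet_wordCylinder u).symm
    -- Distinct words have distinct codes, so the code in the precision of a child makes the errors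
    -- summable even over infinitely many children.
    have h3 : ∑' u : C, (2⁻¹ : ENNReal) ^ Encodable.encode (u : List Bool) ≤ 2 := by
      refine (ENNReal.tsum_comp_le_tsum_of_injective
        (Encodable.encode_injective.comp Subtype.val_injective) fun i => (2⁻¹ : ENNReal) ^ i).trans
        (le_of_eq ?_)
      rw [ENNReal.tsum_geometric, ENNReal.one_sub_inv_two, inv_inv]
    -- The `+ 2` in the precision cancels the factor `4` of the inductive bound; the children then
    -- contribute `2 * 2⁻¹ ^ k`, and the present contraction at most as much again.
    have h4 : (4 : ENNReal) * 2⁻¹ ^ 2 = 1 := by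
      rw [← ENNReal.inv_pow, show (4 : ENNReal) = 2 ^ 2 by norm_num]
      exact ENNReal.mul_inv_cancel (by simp) (by simp)
    calc μ (descendantSet r F (n + 1) (k, w))
        ≤ ∑' u : C, μ (descendantSet r F n (k + Encodable.encode (u : List Bool) + 2, u)) :=
          (measure_mono h1).trans (measure_biUnion_le μ C.to_countable _)
      _ ≤ ∑' u : C, (a ^ n * μ (wordCylinder u) +
            2⁻¹ ^ k * 2⁻¹ ^ Encodable.encode (u : List Bool)) := by
          refine ENNReal.tsum_le_tsum fun u => (ih _ _).trans (le_of_eq ?_)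
          congr 1
          calc (4 : ENNReal) * 2⁻¹ ^ (k + Encodable.encode (u : List Bool) + 2)
              = (4 * 2⁻¹ ^ 2) * (2⁻¹ ^ k * 2⁻¹ ^ Encodable.encode (u : List Bool)) := by
                simp only [pow_add]; ring
            _ = _ := by rw [h4, one_mul]
      _ = a ^ n * μ (⋃ u ∈ C, wordCylinder u) +
            2⁻¹ ^ k * ∑' u : C, 2⁻¹ ^ Encodable.encode (u : List Bool) := by
          rw [ENNReal.tsum_add, ENNReal.tsum_mul_left, ENNReal.tsum_mul_left, h2]
      _ ≤ a ^ n * (a * μ (wordCylinder w) + 2 * 2⁻¹ ^ k) + 2⁻¹ ^ k * 2 := by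
          gcongr
          exact h k w
      _ = a ^ (n + 1) * μ (wordCylinder w) + (a ^ n * (2 * 2⁻¹ ^ k) + 2 * 2⁻¹ ^ k) := by ring
      _ ≤ a ^ (n + 1) * μ (wordCylinder w) + (1 * (2 * 2⁻¹ ^ k) + 2 * 2⁻¹ ^ k) := by
          gcongr
          exact pow_le_one₀ zero_le ha
      _ = _ := by ring

end Descendants

/-! ### Construction of the Martin-Löf test. -/

/-- Amenability is not needed: the averages come from the element of minimal norm in the closed
convex hull of an orbit in `L²`, and are found by a search instead of from a Følner sequence. -/
theorem theoremt (Γ : Set ℕ) [Group Γ] (hΓ : IsComputableGroup Γ) (hA : IsAmenableGroup Γ)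
    [MulAction Γ (ℕ → Bool)] (hact : IsComputableAction Γ)
    (μ : Measure (ℕ → Bool)) [IsProbabilityMeasure μ] (hμ : IsComputableMeasure μ)
    [ErgodicSMul Γ (ℕ → Bool) μ]
    (U : Set (ℕ → Bool)) (hU : IsEffectivelyOpen U) (hU1 : μ U < 1) :
    IsEffectivelyNull μ (⋂ g : Γ, (fun ω : ℕ → Bool => g • ω) ⁻¹' U) := by
  have hmeas := measurable_smul_of_isComputableAction hact
  obtain ⟨E, hE, hEact⟩ := hact
  obtain ⟨S, hS, rfl⟩ := hU
  set U := ⋃ w ∈ S, wordCylinder w with hUdef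
  have hUm : MeasurableSet U := measurableSet_biUnion_wordCylinder S
  obtain ⟨F, hFc, hF⟩ := (REPred.isAveragingList hΓ hE hμ).exists_computable_selection
    fun s => exists_isAveragingList hEact s.1 s.2
  -- An enumeration of cylinders covering the preimage of `U`, uniformly in the group element; `r`
  -- is its stage-by-stage version.
  have hT : REPred fun t : ℕ × List Bool => ∃ z, z ∈ S ∧ (t.1, z, t.2) ∈ E :=
    ((hS.comp_computable Computable.snd).and (hE.comp_computable
      (f := fun t : (ℕ × List Bool) × List Bool => (t.1.1, t.2, t.1.2))
      ((Computable.fst.comp Computable.fst).pair (Computable.snd.pair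
        (Computable.snd.comp Computable.fst))))).exists_snd
  obtain ⟨r, hr, hrT⟩ := hT.exists_primrecRel
  have hgU : ∀ (g : Γ) (x : ℕ → Bool), g • x ∈ U ↔ ∃ v n, r ((g : ℕ), v) n ∧
      x ∈ wordCylinder v := by
    intro g x
    have h1 : ∀ z, g • x ∈ wordCylinder z ↔ ∃ v, ((g : ℕ), z, v) ∈ E ∧ x ∈ wordCylinder v := by
      intro z
      have := Set.ext_iff.1 (hEact g z) x
      simpa using this
    have h2 : ∀ v, (∃ n, r ((g : ℕ), v) n) ↔ ∃ z, z ∈ S ∧ ((g : ℕ), z, v) ∈ E := fun v =>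
      (hrT ((g : ℕ), v)).symm
    simp only [hUdef, Set.mem_iUnion, exists_prop, h1, exists_and_right, h2]
    constructor
    · rintro ⟨z, hz, v, hv, hx⟩
      exact ⟨v, ⟨z, hz, hv⟩, hx⟩
    · rintro ⟨v, ⟨z, hz, hv⟩, hx⟩
      exact ⟨z, hz, v, hv, hx⟩
  have hchild : ∀ k w, μ (⋃ u ∈ {u | IsChild r (F (k, w)) w u}, wordCylinder u) ≤
      μ U * μ (wordCylinder w) + 2 * 2⁻¹ ^ k := by
    intro k w
    have := (hF (k, w)).measureReal_inter_le hEact hUm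
      (X := ⋃ u ∈ {u | IsChild r (F (k, w)) w u}, wordCylinder u)
      (Set.iUnion₂_subset fun u hu => hu.wordCylinder_subset) (by
        intro b hb g hg x hx
        obtain ⟨u, hu, hx⟩ := Set.mem_iUnion₂.1 hx
        rw [hgU, hg]
        exact IsChild.exists_mem hu hx hb)
    have h2 := ENNReal.ofReal_le_ofReal this
    rw [ofReal_measureReal (measure_ne_top _ _)] at h2
    refine h2.trans (le_of_eq ?_)
    rw [ENNReal.ofReal_add (by positivity) (by positivity), ENNReal.ofReal_mul measureReal_nonneg,
      ofReal_measureReal (measure_ne_top _ _), ofReal_measureReal (measure_ne_top _ _),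
      ENNReal.ofReal_mul zero_le_two,
      ENNReal.ofReal_pow (by norm_num)]
    simp
  -- A fixed number `K` is all the algorithm needs to know about `μ U`, which itself need not be
  -- computable.
  obtain ⟨K, hK⟩ : ∃ K, μ U ^ K < 2⁻¹ :=
    ((ENNReal.tendsto_pow_atTop_nhds_zero_of_lt_one hU1).eventually_lt_const (by simp)).exists
  -- Starting from the whole space `[]`, the main term `(μ U ^ K) ^ (N + 2)` and the error `4 * 2⁻¹
  -- ^ (N + 4)` are each at most `2⁻¹ ^ (N + 2)`, so their sum stays below `2⁻¹ ^ N`.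
  refine ⟨fun N => descendantSet r F (K * (N + 2)) (N + 4, []), ⟨⟨{p | ∃ k,
    IterRel (ChildStep r F) (K * (p.1 + 2)) (p.1 + 4, []) (k, p.2)}, ?_, fun n => rfl⟩, ?_⟩, ?_⟩
  · have h1 := (REPred.childStep hr hFc).iterRel
    refine (h1.comp_computable (f := fun y : (ℕ × List Bool) × ℕ =>
      (K * (y.1.1 + 2), ((y.1.1 + 4, ([] : List Bool)), (y.2, y.1.2)))) ?_).exists_snd
    have hN : Primrec fun y : (ℕ × List Bool) × ℕ => y.1.1 := Primrec.fst.comp Primrec.fst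
    exact ((Primrec.nat_mul.comp (Primrec.const K)
      (Primrec.nat_add.comp hN (Primrec.const 2))).pair
      (((Primrec.nat_add.comp hN (Primrec.const 4)).pair (Primrec.const [])).pair
        (Primrec.snd.pair (Primrec.snd.comp Primrec.fst)))).to_comp
  · intro N _
    have h1 := measure_descendantSet_le hU1.le hchild (K * (N + 2)) (N + 4) []
    have h4 : (4 : ENNReal) * 2⁻¹ ^ (N + 4) = 2⁻¹ ^ (N + 2) := by
      rw [show N + 4 = 2 + (N + 2) by ring, pow_add _ 2, ← mul_assoc, ← ENNReal.inv_pow,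
        show (4 : ENNReal) = 2 ^ 2 by norm_num, ENNReal.mul_inv_cancel (by simp) (by simp), one_mul]
    calc μ (descendantSet r F (K * (N + 2)) (N + 4, [])) ≤ _ := h1
      _ ≤ (2⁻¹ : ENNReal) ^ (N + 2) * 1 + 2⁻¹ ^ (N + 2) := by
        rw [h4, pow_mul]
        gcongr
        exact prob_le_one
      _ = 2⁻¹ ^ (N + 1) := by
        rw [mul_one, ← two_mul, pow_succ' _ (N + 1), ← mul_assoc,
          ENNReal.mul_inv_cancel (by simp) (by simp), one_mul]
      _ < 2⁻¹ ^ N := by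
        rw [pow_succ]
        exact ENNReal.mul_lt_of_lt_div' (by
          rw [ENNReal.div_self (by simp) (by simp)]; simp [ENNReal.inv_lt_one])
  · intro x hx
    refine Set.mem_iInter₂.2 fun N _ => ?_
    refine mem_descendantSet (fun s b hb => ?_) _ _ (fun i hi => by simp at hi)
    obtain ⟨g, rfl⟩ := (hF s).1 b hb
    exact (hgU g⁻¹ x).1 (Set.mem_iInter.1 hx g⁻¹)
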